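/- For $n\ge 0$, consider $n$ buyers arriving one by one in the order $1,\dots,n$, with independent nonnegative valuations $X_1,\dots,X_n$ whose laws $\mathcal D_1,\dots,\mathcal D_n$ are continuous (atomless) and have finite mean. A static pricing strategy with full knowledge of the distributions chooses a price $p$ from $(\mathcal D_1,\dots,\mathcal D_n)$, possibly at random but independently of the $X_i$, and sells $k$ identical items to the first $k$ buyers with $X_i>p$ (to all such buyers if there are fewer than $k$); $\mathrm{ALG}$ is the sum of the valuations of the buyers who obtain an item. Its competitive ratio is the largest $\alpha$ such that $\mathbb E[\mathrm{ALG}]\ge\alpha\,\mathbb E[\mathrm{OPT}]$ for all $n$ and all $\mathcal D_1,\dots,\mathcal D_n$, where $\mathrm{OPT}$ is the sum of the $k$ largest of the $X_i$ (of all of them if $n<k$). Let $\rho_k$ be the supremum of the competitive ratios of all such strategies. For every integer $k\ge1$ there is exactly one $\lambda_k\ge0$ such that a Poisson random variable $X$ with mean $\lambda_k$ satisfies $$\frac{\mathbb E[\min(X,k)]}{k}=\Pr(X\le k-1).$$ For every $k\ge 1$, the common value of the two sides equals $\rho_k$, and $\rho_k$ is the competitive ratio of a strategy that uses a deterministic price.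 Moreover, as $k\to\infty$ (with $\log$ the natural logarithm), $$\rho_k=1-\sqrt{\frac{\log k}{k}}+o\!\left(\sqrt{\frac{\log k}{k}}\right)\qquad\text{and}\qquad \lambda_k=k-(1+o(1))\sqrt{k\log k}.$$ -/

import Mathlib

open MeasureTheory ProbabilityTheory Filter Asymptotics Topology
open scoped NNReal

/-- What a seller with full information knows about `n` buyers arriving in the order `0, …, n - 1`:
the laws of their independent valuations, which are nonnegative, continuous (atomless) and have
finite mean. -/
structure ValuationProfile (n : ℕ) where
  law : Fin n → Measure ℝ
  isProbabilityMeasure : ∀ i, IsProbabilityMeasure (law i)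
  noAtoms : ∀ i, NullSingletonClass (law i)
  nonneg : ∀ i, ∀ᵐ v ∂(law i), 0 ≤ v
  integrable : ∀ i, Integrable (fun v : ℝ => v) (law i)

/-- The joint law of the independent valuations `X₀, …, Xₙ₋₁`. -/
noncomputable def ValuationProfile.joint {n : ℕ} (D : ValuationProfile n) :
    Measure (Fin n → ℝ) :=
  haveI := D.isProbabilityMeasure
  Measure.pi D.law

/-- The buyers that obtain one of the `k` items at the static price `p`: those who value an item
above `p` and arrive while fewer than `k` items are sold, that is, fewer than `k` earlier buyers
have valuations above `p`. -/
noncomputable def soldTo {n : ℕ} (k : ℕ) (p : ℝ) (x : Fin n → ℝ) : Finset (Fin n) :=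
  Finset.univ.filter fun i =>
    p < x i ∧ (Finset.univ.filter fun j : Fin n => j < i ∧ p < x j).card < k

/-- The social welfare of the static price `p` on the valuations `x`. -/
noncomputable def welfare {n : ℕ} (k : ℕ) (p : ℝ) (x : Fin n → ℝ) : ℝ :=
  ∑ i ∈ soldTo k p x, x i

/-- The prophet's welfare: the largest total valuation of a set of at most `k` buyers. For
nonnegative valuations this is the sum of the `k` largest ones (of all of them if `n < k`). -/
noncomputable def prophetWelfare {n : ℕ} (k : ℕ) (x : Fin n → ℝ) : ℝ :=
  (Finset.univ.filter fun S : Finset (Fin n) => S.card ≤ k).sup'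
    ⟨∅, by simp⟩ fun S => ∑ i ∈ S, x i

/-- A (possibly randomized) static pricing strategy with full knowledge of the distributions:
it chooses the law of the price, which is drawn independently of the valuations. -/
abbrev StaticPricing : Type := ∀ n : ℕ, ValuationProfile n → ProbabilityMeasure ℝ

/-- The strategy that posts the deterministic price `price n D` on the profile `D`. -/
noncomputable def StaticPricing.deterministic (price : ∀ n : ℕ, ValuationProfile n → ℝ) :
    StaticPricing :=
  fun n D => ⟨Measure.dirac (price n D), inferInstance⟩

/-- The expected welfare of the strategy `σ` with `k` items on the profile `D`. -/
noncomputable def StaticPricing.expectedWelfare (k : ℕ) (σ : StaticPricing) {n : ℕ}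
    (D : ValuationProfile n) : ℝ :=
  ∫ p, ∫ x, welfare k p x ∂D.joint ∂(σ n D : Measure ℝ)

/-- `σ` is `α`-competitive with `k` items: on every profile it obtains in expectation at least an
`α` fraction of the prophet's expected welfare. -/
def StaticPricing.IsCompetitive (k : ℕ) (σ : StaticPricing) (α : ℝ) : Prop :=
  ∀ (n : ℕ) (D : ValuationProfile n),
    α * ∫ x, prophetWelfare k x ∂D.joint ≤ σ.expectedWelfare k D

/-- The competitive ratio of `σ` with `k` items. -/
noncomputable def StaticPricing.competitiveRatio (k : ℕ) (σ : StaticPricing) : ℝ :=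
  sSup {α : ℝ | σ.IsCompetitive k α}

/-- The best competitive ratio of a static pricing strategy with `k` items. -/
noncomputable def optimalStaticRatio (k : ℕ) : ℝ :=
  ⨆ σ : StaticPricing, σ.competitiveRatio k

/-- `E[min(X, k)] / k` for a Poisson random variable `X` of mean `μ`. -/
noncomputable def poissonSoldFraction (k : ℕ) (μ : ℝ≥0) : ℝ :=
  (∫ m : ℕ, min (m : ℝ) (k : ℝ) ∂(poissonMeasure μ)) / k

/-- `Pr(X ≤ k - 1)`, that is, `Pr(X < k)`, for a Poisson random variable `X` of mean `μ`. -/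
noncomputable def poissonNotSoldOut (k : ℕ) (μ : ℝ≥0) : ℝ :=
  (poissonMeasure μ).real {m : ℕ | m < k}

/-! ### The Poisson distribution function -/

/-! Let `N` be the number of buyers above the price `p`. A sale is worth `p` plus a surplus, which
gives E[ALG] ≥ p·E[min(N, k)] + P(N < k)·∑ E(Xᵢ - p)⁺, because a buyer surely finds an item if `N <
k`, and the stock met on arrival is independent of the buyer's own value. Also E[OPT] ≤ k·p + ∑ E(Xᵢ
- p)⁺. So a price guarantees the smaller of E[min(N, k)]/k and P(N < k). Atomless laws allow P(N <
k) to be tuned to its value ρ for the balanced Poisson variable. It remains to see that E[min(N, k)]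
is then at least the Poisson value. Since E[min(N, k)] = k - ∑_{i ≤ k} P(N < i), it suffices that
P(N < i) is at most its Poisson counterpart for all i ≤ k. This is
`sum_successWeight_le_poissonBelow`: the law of `N` is ultra-log-concave, so its ratio to a Poisson
law is log-concave and exceeds a given level only on an interval. For optimality, many buyers worth
about `M` precede one worth about `W * M ^ 2` with probability `M⁻¹`. To leading order in `M`, a
price accepted by each typical buyer with probability q earns M·(E[min(B, k)] + W·P(B < k)) with `B`
binomial, against M·(k + W) for the prophet. The multiplier `W` is chosen so that the balanced rate
maximizes this tradeoff (`binomialTradeoff_le`). In the Poisson limit the bound reads α·(k + W) ≤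
ρ·(k + W). For the asymptotics, the balance condition at the rate λ is (k - λ)·P(X < k) = k·P(X >
k). Chernoff's bound and Stirling's formula determine the sign of the difference at λ = k - c·√(k
log k) for c = 1 and for c < 1, and dividing the equation by k turns the rate into the ratio. -/

/-- The probability that a Poisson variable of mean `x` equals `j`. -/
noncomputable def poissonWeight (j : ℕ) (x : ℝ) : ℝ := Real.exp (-x) * x ^ j / j.factorial

/-- The probability that a Poisson variable of mean `x` is smaller than `i`. -/
noncomputable def poissonBelow (i : ℕ) (x : ℝ) : ℝ := ∑ j ∈ Finset.range i, poissonWeight j x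

lemma poissonWeight_pos (j : ℕ) {x : ℝ} (hx : 0 < x) : 0 < poissonWeight j x := by
  unfold poissonWeight; positivity

lemma poissonWeight_nonneg (j : ℕ) {x : ℝ} (hx : 0 ≤ x) : 0 ≤ poissonWeight j x := by
  unfold poissonWeight; positivity

lemma poissonBelow_succ (i : ℕ) (x : ℝ) :
    poissonBelow (i + 1) x = poissonBelow i x + poissonWeight i x :=
  Finset.sum_range_succ _ _

lemma hasSum_poissonWeight (x : ℝ) : HasSum (fun j => poissonWeight j x) 1 := by
  have h := (NormedSpace.expSeries_div_hasSum_exp x).mul_left (Real.exp (-x))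
  rw [← Real.exp_eq_exp_ℝ, ← Real.exp_add, neg_add_cancel, Real.exp_zero] at h
  simpa only [poissonWeight, mul_div_assoc] using h

lemma poissonBelow_le_one (i : ℕ) {x : ℝ} (hx : 0 ≤ x) : poissonBelow i x ≤ 1 :=
  sum_le_hasSum _ (fun j _ => poissonWeight_nonneg j hx) (hasSum_poissonWeight x)

lemma poissonBelow_lt_one (i : ℕ) {x : ℝ} (hx : 0 < x) : poissonBelow i x < 1 := by
  have := poissonBelow_le_one (i + 1) hx.le
  have h := poissonWeight_pos i hx
  rw [poissonBelow_succ] at this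
  linarith

lemma poissonBelow_nonneg (i : ℕ) {x : ℝ} (hx : 0 ≤ x) : 0 ≤ poissonBelow i x :=
  Finset.sum_nonneg fun j _ => poissonWeight_nonneg j hx

lemma poissonBelow_mono {i j : ℕ} (hij : i ≤ j) {x : ℝ} (hx : 0 ≤ x) :
    poissonBelow i x ≤ poissonBelow j x :=
  Finset.sum_le_sum_of_subset_of_nonneg (Finset.range_mono hij)
    fun l _ _ => poissonWeight_nonneg l hx

lemma poissonBelow_pos {i : ℕ} (hi : 1 ≤ i) {x : ℝ} (hx : 0 ≤ x) : 0 < poissonBelow i x := by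
  refine lt_of_lt_of_le ?_ (poissonBelow_mono hi hx)
  simp [poissonBelow, poissonWeight, Real.exp_pos]

lemma poissonBelow_zero_right (i : ℕ) : poissonBelow (i + 1) 0 = 1 := by
  simp [poissonBelow, poissonWeight, Finset.sum_range_succ']

lemma tendsto_poissonBelow (i : ℕ) : Tendsto (poissonBelow i) atTop (𝓝 0) := by
  have : Tendsto (fun x : ℝ => ∑ j ∈ Finset.range i, poissonWeight j x) atTop
      (𝓝 (∑ j ∈ Finset.range i, 0)) := by
    refine tendsto_finsetSum _ fun j _ => ?_
    have h := (Real.tendsto_pow_mul_exp_neg_atTop_nhds_zero j).div_const (j.factorial : ℝ)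
    rw [zero_div] at h
    exact h.congr fun x => by rw [poissonWeight, mul_comm]
  rw [Finset.sum_const_zero] at this
  exact this

lemma poissonNotSoldOut_eq (k : ℕ) (μ : ℝ≥0) : poissonNotSoldOut k μ = poissonBelow k μ := by
  have h : {m : ℕ | m < k} = ↑(Finset.range k) := by ext; simp
  rw [poissonNotSoldOut, h, ← sum_measureReal_singleton]
  simp only [poissonMeasure_real_singleton, poissonBelow, poissonWeight]

/-- The minimum counts the `i < k` with `i < m`; counting the complement leaves only events of the
form `m < i + 1`. -/
lemma min_eq_sub_sum_ite (m k : ℕ) :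
    min (m : ℝ) k = k - ∑ i ∈ Finset.range k, if m < i + 1 then (1 : ℝ) else 0 := by
  induction k with
  | zero => simp
  | succ k ih =>
    rw [Finset.sum_range_succ]
    have h : min (m : ℝ) (k + 1 : ℕ) = min (m : ℝ) k + if m < k + 1 then 0 else 1 := by
      split_ifs with h
      · rw [min_eq_left (by exact_mod_cast h.le), min_eq_left (by exact_mod_cast (by omega)),
          add_zero]
      · rw [min_eq_right (by exact_mod_cast (by omega)),
          min_eq_right (by exact_mod_cast (by omega))]
        push_cast; ring
    rw [h, ih]
    push_cast
    split_ifs <;> ring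

/-- The expected minimum of `k` and a random natural number, through its distribution function. -/
lemma integral_min_eq_sub_sum {Ω : Type*} [MeasurableSpace Ω] (P : Measure Ω)
    [IsProbabilityMeasure P] {N : Ω → ℕ} (hN : Measurable N) (k : ℕ) :
    ∫ ω, min (N ω : ℝ) k ∂P = k - ∑ i ∈ Finset.range k, P.real {ω | N ω < i + 1} := by
  have hm : ∀ i, MeasurableSet {ω | N ω < i + 1} := fun i => measurableSet_lt hN measurable_const
  have e : ∀ i, (fun ω => if N ω < i + 1 then (1 : ℝ) else 0)
      = {ω | N ω < i + 1}.indicator fun _ => 1 := by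
    intro i; ext ω; simp [Set.indicator_apply]
  have hi : ∀ i, Integrable (fun ω => if N ω < i + 1 then (1 : ℝ) else 0) P := by
    intro i; rw [e]; exact (integrable_const _).indicator (hm i)
  simp only [min_eq_sub_sum_ite]
  rw [integral_sub (integrable_const _) (integrable_finsetSum _ fun i _ => hi i),
    integral_finsetSum _ fun i _ => hi i]
  congr 1
  · simp
  · refine Finset.sum_congr rfl fun i _ => ?_
    rw [e, integral_indicator (hm i)]
    simp

lemma poissonSoldFraction_eq (k : ℕ) (μ : ℝ≥0) :
    poissonSoldFraction k μ
      = (k - ∑ i ∈ Finset.range k, poissonBelow (i + 1) μ) / k := by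
  rw [poissonSoldFraction, integral_min_eq_sub_sum (poissonMeasure μ) (N := fun m => m)
    measurable_id]
  simp only [← poissonNotSoldOut_eq, poissonNotSoldOut]

lemma hasDerivAt_poissonWeight_zero (x : ℝ) :
    HasDerivAt (poissonWeight 0) (-poissonWeight 0 x) x := by
  have h : HasDerivAt (fun y => Real.exp (-y)) (-Real.exp (-x)) x := by
    simpa using (hasDerivAt_neg x).exp
  have e : poissonWeight 0 = fun y => Real.exp (-y) := by ext; simp [poissonWeight]
  rw [e]; exact h

lemma hasDerivAt_poissonWeight_succ (j : ℕ) (x : ℝ) :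
    HasDerivAt (poissonWeight (j + 1)) (poissonWeight j x - poissonWeight (j + 1) x) x := by
  have h : HasDerivAt (poissonWeight (j + 1)) _ x :=
    (((hasDerivAt_neg x).exp).mul (hasDerivAt_pow (j + 1) x)).div_const ((j + 1).factorial : ℝ)
  refine h.congr_deriv ?_
  simp only [poissonWeight, Nat.factorial_succ]
  have : (j.factorial : ℝ) ≠ 0 := by positivity
  push_cast
  field_simp
  ring

/-- The derivatives of consecutive weights telescope, so only the last weight survives. -/
lemma hasDerivAt_poissonBelow (i : ℕ) (x : ℝ) :
    HasDerivAt (poissonBelow (i + 1)) (-poissonWeight i x) x := by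
  induction i with
  | zero =>
    have : poissonBelow (0 + 1) = poissonWeight 0 := by ext; simp [poissonBelow]
    rw [this]; exact hasDerivAt_poissonWeight_zero x
  | succ i ih =>
    have : poissonBelow (i + 1 + 1) = poissonBelow (i + 1) + poissonWeight (i + 1) := by
      ext y; exact poissonBelow_succ _ _
    rw [this]
    refine (ih.add (hasDerivAt_poissonWeight_succ i x)).congr_deriv ?_
    ring

lemma strictAntiOn_poissonBelow (i : ℕ) :
    StrictAntiOn (poissonBelow (i + 1)) (Set.Ici 0) := by
  refine strictAntiOn_of_deriv_neg (convex_Ici 0)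
    (fun x _ => (hasDerivAt_poissonBelow i x).continuousAt.continuousWithinAt) fun x hx => ?_
  rw [interior_Ici] at hx
  rw [(hasDerivAt_poissonBelow i x).deriv]
  exact neg_neg_of_pos (poissonWeight_pos i hx)

/-- `∑_{i ≤ k} P(X < i)` for a Poisson variable `X`, in closed form. -/
lemma sum_poissonBelow (k : ℕ) (x : ℝ) :
    ∑ i ∈ Finset.range k, poissonBelow (i + 1) x
      = (k - x) * poissonBelow k x + k * poissonWeight k x := by
  induction k with
  | zero => simp [poissonBelow]
  | succ k ih =>
    have hw : (k + 1 : ℝ) * poissonWeight (k + 1) x = x * poissonWeight k x := by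
      simp only [poissonWeight, Nat.factorial_succ]
      have : (k.factorial : ℝ) ≠ 0 := by positivity
      push_cast
      field_simp
      ring
    rw [Finset.sum_range_succ, ih, poissonBelow_succ]
    push_cast
    rw [hw]
    ring

/-- `k P(X < k) + ∑_{i ≤ k} P(X < i)`, which decreases from `2 k` to `0` and equals `k` when the
two sides of the equation that defines the optimal rate agree. -/
noncomputable def poissonBalance (k : ℕ) (x : ℝ) : ℝ :=
  k * poissonBelow k x + ∑ i ∈ Finset.range k, poissonBelow (i + 1) x

lemma strictAntiOn_poissonBalance {k : ℕ} (hk : 1 ≤ k) :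
    StrictAntiOn (poissonBalance k) (Set.Ici 0) := by
  intro x hx y hy hxy
  obtain ⟨k, rfl⟩ : ∃ l, k = l + 1 := ⟨k - 1, by omega⟩
  refine add_lt_add (mul_lt_mul_of_pos_left (strictAntiOn_poissonBelow k hx hy hxy)
    (by positivity)) (Finset.sum_lt_sum_of_nonempty (by simp) fun i _ =>
      strictAntiOn_poissonBelow i hx hy hxy)

lemma continuous_poissonBelow (i : ℕ) : Continuous (poissonBelow i) := by
  unfold poissonBelow poissonWeight
  fun_prop

/-- Intermediate value theorem between the value `2 * k` at zero and the limit zero at infinity. -/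
lemma exists_poissonBalance_eq {k : ℕ} (hk : 1 ≤ k) : ∃ x : ℝ, 0 < x ∧ poissonBalance k x = k := by
  have hc : Continuous (poissonBalance k) := by
    unfold poissonBalance
    have := continuous_poissonBelow
    fun_prop
  have h0 : poissonBalance k 0 = 2 * k := by
    obtain ⟨k, rfl⟩ : ∃ l, k = l + 1 := ⟨k - 1, by omega⟩
    simp [poissonBalance, poissonBelow_zero_right]
    ring
  have hk' : (0 : ℝ) < k := by exact_mod_cast hk
  have ht : Tendsto (poissonBalance k) atTop (𝓝 0) := by
    have := ((tendsto_poissonBelow k).const_mul (k : ℝ)).add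
      (tendsto_finsetSum (Finset.range k) fun i _ => tendsto_poissonBelow (i + 1))
    rw [mul_zero, Finset.sum_const_zero, add_zero] at this
    exact this
  obtain ⟨b, hb, hb0⟩ := ((ht.eventually_lt_const hk').and (eventually_ge_atTop 0)).exists
  obtain ⟨x, hx, hxk⟩ := intermediate_value_Icc' hb0 hc.continuousOn
    (show (k : ℝ) ∈ Set.Icc _ _ from ⟨hb.le, by rw [h0]; linarith⟩)
  refine ⟨x, lt_of_le_of_ne hx.1 ?_, hxk⟩
  rintro rfl
  rw [h0] at hxk
  linarith

/-- The rate at which a Poisson variable balances the two guarantees of a static price. -/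
noncomputable def balancedRate (k : ℕ) : ℝ :=
  -- The default value keeps the rate nonnegative for every `k`.
  if hk : 1 ≤ k then (exists_poissonBalance_eq hk).choose else 0

lemma balancedRate_pos {k : ℕ} (hk : 1 ≤ k) : 0 < balancedRate k := by
  rw [balancedRate, dif_pos hk]
  exact (exists_poissonBalance_eq hk).choose_spec.1

lemma balancedRate_nonneg (k : ℕ) : 0 ≤ balancedRate k := by
  by_cases hk : 1 ≤ k
  · exact (balancedRate_pos hk).le
  · rw [balancedRate, dif_neg hk]

lemma poissonBalance_balancedRate {k : ℕ} (hk : 1 ≤ k) : poissonBalance k (balancedRate k) = k := by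
  rw [balancedRate, dif_pos hk]
  exact (exists_poissonBalance_eq hk).choose_spec.2

lemma poissonSoldFraction_eq_iff {k : ℕ} (hk : 1 ≤ k) (μ : ℝ≥0) :
    poissonSoldFraction k μ = poissonNotSoldOut k μ ↔ (μ : ℝ) = balancedRate k := by
  have hk' : (k : ℝ) ≠ 0 := by positivity
  rw [← (strictAntiOn_poissonBalance hk).injOn.eq_iff (Set.mem_Ici.2 (NNReal.coe_nonneg μ))
    (Set.mem_Ici.2 (balancedRate_nonneg k)), poissonBalance_balancedRate hk,
    poissonSoldFraction_eq, poissonNotSoldOut_eq, div_eq_iff hk', poissonBalance]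
  constructor <;> intro h <;> linarith

/-- The common value of the two guarantees at the balanced rate. -/
noncomputable def balancedRatio (k : ℕ) : ℝ := poissonBelow k (balancedRate k)

/-- In other words E[min(X, k)] = k·ρ at the balanced rate, the form that both bounds use. -/
lemma sum_poissonBelow_balancedRate {k : ℕ} (hk : 1 ≤ k) :
    ∑ i ∈ Finset.range k, poissonBelow (i + 1) (balancedRate k) = k - k * balancedRatio k := by
  have := poissonBalance_balancedRate hk
  rw [poissonBalance] at this
  rw [balancedRatio]
  linarith

lemma balancedRatio_pos {k : ℕ} (hk : 1 ≤ k) : 0 < balancedRatio k :=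
  poissonBelow_pos hk (balancedRate_nonneg k)

lemma balancedRatio_lt_one {k : ℕ} (hk : 1 ≤ k) : balancedRatio k < 1 :=
  poissonBelow_lt_one k (balancedRate_pos hk)

/-! ### Ultra-log-concavity and comparison with the Poisson distribution -/

/-- Log-concavity without internal zeros of a nonnegative sequence. -/
structure StronglyLogConcave (A : ℕ → ℝ) : Prop where
  nonneg : ∀ j, 0 ≤ A j
  -- Allowing `i < j`, and not only `i = j`, is what excludes internal zeros.
  mul_le : ∀ i j, i ≤ j → A i * A (j + 2) ≤ A (i + 1) * A (j + 1)

lemma StronglyLogConcave.mul_succ_le {A : ℕ → ℝ} (hA : StronglyLogConcave A) {i j : ℕ}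
    (hij : i ≤ j) : A i * A (j + 1) ≤ A (i + 1) * A j := by
  obtain rfl | h := hij.eq_or_lt
  · rw [mul_comm]
  · obtain ⟨j, rfl⟩ : ∃ l, j = l + 1 := ⟨j - 1, by omega⟩
    exact hA.mul_le i j (by omega)

/-- A nonnegative log-concave sequence exceeds a geometric one on an interval. -/
lemma StronglyLogConcave.geometric_le {A : ℕ → ℝ} (hA : StronglyLogConcave A) {c x : ℝ}
    (hc : 0 < c) (hx : 0 < x) {i m l : ℕ} (him : i ≤ m) (hml : m ≤ l)
    (hi : c * x ^ i ≤ A i) (hl : c * x ^ l ≤ A l) : c * x ^ m ≤ A m := by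
  induction h : l - i generalizing i l with
  | zero =>
    obtain rfl : m = i := by omega
    exact hi
  | succ d ih =>
    obtain rfl | h1 := him.eq_or_lt
    · exact hi
    obtain rfl | h2 := hml.eq_or_lt
    · exact hl
    obtain ⟨l, rfl⟩ : ∃ t, l = t + 2 := ⟨l - 2, by omega⟩
    by_cases hi' : c * x ^ (i + 1) ≤ A (i + 1)
    · exact ih h1 hml hi' hl (by omega)
    by_cases hl' : c * x ^ (l + 1) ≤ A (l + 1)
    · exact ih him (by omega) hi hl' (by omega)
    -- If both inner neighbours of the endpoints lie below the geometric sequence, their product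
    -- lies below that of the endpoints, against log-concavity. Otherwise the interval shrinks.
    exfalso
    push Not at hi' hl'
    have h3 := hA.mul_le i l (by omega)
    have h4 : c * x ^ i * (c * x ^ (l + 2)) ≤ A i * A (l + 2) :=
      mul_le_mul hi hl (by positivity) (hA.nonneg i)
    have h5 : A (i + 1) * A (l + 1) < c * x ^ (i + 1) * (c * x ^ (l + 1)) :=
      mul_lt_mul'' hi' hl' (hA.nonneg _) (hA.nonneg _)
    have h6 : c * x ^ (i + 1) * (c * x ^ (l + 1)) = c * x ^ i * (c * x ^ (l + 2)) := by ring
    linarith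

/-- Adding an independent Bernoulli variable preserves ultra-log-concavity. -/
lemma StronglyLogConcave.add_bernoulli {A B : ℕ → ℝ} (hA : StronglyLogConcave A) {q : ℝ}
    (hq0 : 0 ≤ q) (hq1 : q ≤ 1) (h0 : B 0 = (1 - q) * A 0)
    (hs : ∀ j : ℕ, B (j + 1) = (1 - q) * A (j + 1) + q * ((j + 1) * A j)) :
    StronglyLogConcave B := by
  have hr : 0 ≤ 1 - q := by linarith
  constructor
  · rintro (_ | j)
    · rw [h0]; exact mul_nonneg hr (hA.nonneg 0)
    · rw [hs]
      have := hA.nonneg j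
      have := hA.nonneg (j + 1)
      positivity
  · rintro (_ | i) j hij
    · have t1 := mul_nonneg (mul_nonneg hr hr) (sub_nonneg.2 (hA.mul_le 0 j hij))
      have t2 := mul_nonneg (mul_nonneg hq0 hr)
        (mul_nonneg (show (0 : ℝ) ≤ j + 1 by positivity) (sub_nonneg.2 (hA.mul_succ_le hij)))
      have t3 := mul_nonneg (mul_nonneg hq0 hq0)
        (mul_nonneg (show (0 : ℝ) ≤ j + 1 by positivity) (mul_nonneg (hA.nonneg 0) (hA.nonneg j)))
      rw [h0, hs, hs, hs, ← sub_nonneg]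
      refine (add_nonneg (add_nonneg t1 t2) t3).trans_eq ?_
      push_cast
      ring
    -- The difference of the two sides is a quadratic form in `1 - q` and `q`, here split into
    -- nonnegative terms. The coefficient in `t5` is (i + 2)(j + 2) - (i + 1)(j + 3), left over
    -- because the factorials enter the recursion.
    · have hij' : (i : ℝ) + 1 ≤ j := by exact_mod_cast hij
      obtain ⟨j, rfl⟩ : ∃ l, j = l + 1 := ⟨j - 1, by omega⟩
      have t1 := mul_nonneg (mul_nonneg hr hr) (sub_nonneg.2 (hA.mul_le (i + 1) (j + 1) hij))
      have t2 := mul_nonneg (mul_nonneg hq0 hr)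
        (mul_nonneg (show (0 : ℝ) ≤ j + 2 by positivity)
          (sub_nonneg.2 (hA.mul_succ_le (i := i + 1) (j := j + 1) hij)))
      have t3 := mul_nonneg (mul_nonneg hq0 hr)
        (mul_nonneg (show (0 : ℝ) ≤ i + 1 by positivity)
          (sub_nonneg.2 (hA.mul_le i (j + 1) (by omega))))
      have t4 := mul_nonneg (mul_nonneg hq0 hq0)
        (mul_nonneg (show (0 : ℝ) ≤ (i + 1) * (j + 3) by positivity)
          (sub_nonneg.2 (hA.mul_le i j (by omega))))
      have t5 := mul_nonneg (mul_nonneg hq0 hq0)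
        (mul_nonneg (show (0 : ℝ) ≤ j + 1 - i by push_cast at hij'; linarith)
          (mul_nonneg (hA.nonneg (i + 1)) (hA.nonneg (j + 1))))
      rw [hs, hs, hs, hs, ← sub_nonneg]
      refine (add_nonneg (add_nonneg (add_nonneg (add_nonneg t1 t2) t3) t4) t5).trans_eq ?_
      push_cast
      ring

/-! ### Sums of independent Bernoulli variables -/

section PoissonBinomial

open Polynomial

variable {ι : Type*}

/-- The probability of exactly `j` successes among independent trials, indexed by `S`, with success
probabilities `q`. -/
noncomputable def successWeight (q : ι → ℝ) (S : Finset ι) (j : ℕ) : ℝ :=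
  (∏ i ∈ S, (C (1 - q i) + C (q i) * X)).coeff j

lemma successWeight_empty (q : ι → ℝ) (j : ℕ) :
    successWeight q ∅ j = if j = 0 then 1 else 0 := by
  simp [successWeight, coeff_one]

lemma successWeight_insert_zero [DecidableEq ι] (q : ι → ℝ) {S : Finset ι} {a : ι} (ha : a ∉ S) :
    successWeight q (insert a S) 0 = (1 - q a) * successWeight q S 0 := by
  simp [successWeight, Finset.prod_insert ha, add_mul, mul_assoc]

lemma successWeight_insert_succ [DecidableEq ι] (q : ι → ℝ) {S : Finset ι} {a : ι}
    (ha : a ∉ S) (j : ℕ) :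
    successWeight q (insert a S) (j + 1)
      = (1 - q a) * successWeight q S (j + 1) + q a * successWeight q S j := by
  simp only [successWeight, Finset.prod_insert ha, add_mul, mul_assoc, coeff_C_mul, coeff_add,
    coeff_X_mul]

lemma sum_successWeight_insert [DecidableEq ι] (q : ι → ℝ) {S : Finset ι} {a : ι}
    (ha : a ∉ S) (m : ℕ) :
    ∑ j ∈ Finset.range (m + 1), successWeight q (insert a S) j
      = (1 - q a) * ∑ j ∈ Finset.range (m + 1), successWeight q S j
        + q a * ∑ j ∈ Finset.range m, successWeight q S j := by
  rw [Finset.sum_range_succ', Finset.sum_range_succ' _ m, successWeight_insert_zero q ha]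
  simp only [successWeight_insert_succ q ha, Finset.sum_add_distrib, ← Finset.mul_sum]
  ring

lemma sum_successWeight_eq_one (q : ι → ℝ) (S : Finset ι) {m : ℕ} (hm : S.card < m) :
    ∑ j ∈ Finset.range m, successWeight q S j = 1 := by
  classical
  induction S using Finset.induction_on generalizing m with
  | empty =>
    obtain ⟨m, rfl⟩ : ∃ l, m = l + 1 := ⟨m - 1, by simp at hm; omega⟩
    simp [successWeight_empty]
  | insert a S ha ih =>
    rw [Finset.card_insert_of_notMem ha] at hm
    obtain ⟨m, rfl⟩ : ∃ l, m = l + 1 := ⟨m - 1, by omega⟩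
    rw [sum_successWeight_insert q ha, ih (by omega), ih (by omega)]
    ring

/-- Up to a geometric factor, multiplying by `j!` divides by a Poisson weight. The property holds
without trials, and `add_bernoulli` adds them one at a time. -/
lemma stronglyLogConcave_successWeight {q : ι → ℝ} (hq0 : ∀ i, 0 ≤ q i) (hq1 : ∀ i, q i ≤ 1)
    (S : Finset ι) : StronglyLogConcave fun j => j.factorial * successWeight q S j := by
  classical
  induction S using Finset.induction_on with
  | empty =>
    constructor
    · intro j
      rw [successWeight_empty]
      split_ifs <;> positivity
    · intro i j _
      simp [successWeight_empty]
  | insert a S ha ih =>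
    refine ih.add_bernoulli (hq0 a) (hq1 a) ?_ fun j => ?_
    · simp only [successWeight_insert_zero q ha]
      ring
    · simp only [successWeight_insert_succ q ha, Nat.factorial_succ]
      push_cast
      ring

/-- If a sum of independent Bernoulli variables is at most as likely to stay below `k` as a Poisson
variable, then the same holds for every smaller threshold. -/
lemma sum_successWeight_le_poissonBelow {q : ι → ℝ} (hq0 : ∀ i, 0 ≤ q i) (hq1 : ∀ i, q i ≤ 1)
    (S : Finset ι) {x : ℝ} (hx : 0 < x) {k : ℕ}
    (hk : ∑ j ∈ Finset.range k, successWeight q S j ≤ poissonBelow k x) {i : ℕ} (hi : i ≤ k) :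
    ∑ j ∈ Finset.range i, successWeight q S j ≤ poissonBelow i x := by
  have hA := stronglyLogConcave_successWeight hq0 hq1 S
  have key : ∀ j, poissonWeight j x ≤ successWeight q S j ↔
      Real.exp (-x) * x ^ j ≤ j.factorial * successWeight q S j := by
    intro j
    rw [poissonWeight, div_le_iff₀ (by positivity), mul_comm (successWeight q S j)]
  by_contra! h
  obtain ⟨m, hm, hmw⟩ := Finset.exists_lt_of_sum_lt h
  have hm' := Finset.mem_range.1 hm
  have e1 := Finset.sum_range_add_sum_Ico (fun j => successWeight q S j) hi
  have e2 := Finset.sum_range_add_sum_Ico (fun j => poissonWeight j x) hi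
  have h1 : ∑ j ∈ Finset.Ico i k, successWeight q S j < ∑ j ∈ Finset.Ico i k, poissonWeight j x := by
    simp only [poissonBelow] at h hk
    linarith
  obtain ⟨l, hl, hlw⟩ := Finset.exists_lt_of_sum_lt h1
  have hl' := Finset.mem_Ico.1 hl
  -- There is an excess over the Poisson weight at `m < i` and a deficit at `l ≥ i`. A second excess
  -- beyond `l` would force one at `l`, so the deficit persists.
  have h2 : ∀ j, l ≤ j → successWeight q S j < poissonWeight j x := by
    intro j hj
    by_contra! hj'
    refine hlw.not_ge ((key l).2 ?_)
    exact hA.geometric_le (Real.exp_pos _) hx (by omega) hj ((key m).1 hmw.le) ((key j).1 hj')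
  have h3 := Finset.sum_range_add_sum_Ico (fun j => successWeight q S j)
    (show k ≤ k + S.card + 1 by omega)
  have h4 := Finset.sum_range_add_sum_Ico (fun j => poissonWeight j x)
    (show k ≤ k + S.card + 1 by omega)
  have h5 : ∑ j ∈ Finset.Ico k (k + S.card + 1), successWeight q S j
      ≤ ∑ j ∈ Finset.Ico k (k + S.card + 1), poissonWeight j x :=
    Finset.sum_le_sum fun j hj => (h2 j (by have := Finset.mem_Ico.1 hj; omega)).le
  -- Below `k + S.card + 1` the trials have all their mass and the Poisson variable does not, yet
  -- the trials have no more mass below `k` and no more from `k` on.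
  have h6 := poissonBelow_lt_one (k + S.card + 1) hx
  have h7 := sum_successWeight_eq_one q S (show S.card < k + S.card + 1 by omega)
  simp only [poissonBelow] at h6 hk
  linarith

end PoissonBinomial

/-! ### The number of buyers above the price -/

section Count

variable {ι : Type*}

/-- The number of buyers in `S` whose valuation exceeds the price. -/
noncomputable def countAbove (p : ℝ) (S : Finset ι) (x : ι → ℝ) : ℕ :=
  (S.filter fun j => p < x j).card

lemma countAbove_eq_sum (p : ℝ) (S : Finset ι) (x : ι → ℝ) :
    countAbove p S x = ∑ j : S, if p < x j then 1 else 0 := by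
  rw [countAbove, Finset.card_filter, Finset.sum_coe_sort S fun j => if p < x j then 1 else 0]

lemma countAbove_mono (p : ℝ) {S T : Finset ι} (h : S ⊆ T) (x : ι → ℝ) :
    countAbove p S x ≤ countAbove p T x :=
  Finset.card_le_card (Finset.filter_subset_filter _ h)

lemma countAbove_insert [DecidableEq ι] (p : ℝ) {S : Finset ι} {a : ι} (ha : a ∉ S) (x : ι → ℝ) :
    countAbove p (insert a S) x = countAbove p S x + if p < x a then 1 else 0 := by
  rw [countAbove, Finset.card_filter, Finset.sum_insert ha, ← Finset.card_filter, add_comm]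
  rfl

lemma measurable_countAbove_restrict (p : ℝ) (S : Finset ι) :
    Measurable fun y : S → ℝ => ∑ j : S, if p < y j then 1 else 0 :=
  Finset.measurable_sum _ fun j _ => Measurable.ite
    (measurableSet_lt measurable_const (measurable_pi_apply j)) measurable_const measurable_const

lemma measurable_countAbove (p : ℝ) (S : Finset ι) :
    Measurable (countAbove p S : (ι → ℝ) → ℕ) := by
  have h := (measurable_countAbove_restrict p S).comp
    (measurable_pi_lambda (fun (x : ι → ℝ) (j : S) => x j) fun j => measurable_pi_apply _)
  have e : (countAbove p S : (ι → ℝ) → ℕ) = fun x => ∑ j : S, if p < x j then 1 else 0 :=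
    funext (countAbove_eq_sum p S)
  rw [e]
  exact h

lemma measurableSet_countAbove_lt (p : ℝ) (S : Finset ι) (k : ℕ) :
    MeasurableSet {x : ι → ℝ | countAbove p S x < k} :=
  measurableSet_lt (measurable_countAbove p S) measurable_const

variable [Fintype ι] (μ : ι → Measure ℝ) [∀ i, IsProbabilityMeasure (μ i)]

lemma indepFun_eval_countAbove (p : ℝ) {S : Finset ι} {a : ι} (ha : a ∉ S) :
    IndepFun (fun x : ι → ℝ => x a) (countAbove p S) (Measure.pi μ) := by
  have h1 : iIndepFun (fun i (x : ι → ℝ) => x i) (Measure.pi μ) :=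
    iIndepFun_pi (X := fun _ => id) fun _ => aemeasurable_id
  have h2 := h1.indepFun_finset {a} S (by simpa using ha) fun i => measurable_pi_apply i
  have hφ : Measurable fun y : ({a} : Finset ι) → ℝ => y ⟨a, by simp⟩ := measurable_pi_apply _
  have h3 := h2.comp hφ (measurable_countAbove_restrict p S)
  have e : (countAbove p S : (ι → ℝ) → ℕ) = fun x => ∑ j : S, if p < x j then 1 else 0 :=
    funext (countAbove_eq_sum p S)
  rw [e]
  exact h3

/-- Conditioning on whether buyer `a` exceeds the price gives the recursion of
`sum_successWeight_insert`. -/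
lemma measureReal_countAbove_lt (p : ℝ) (S : Finset ι) (m : ℕ) :
    (Measure.pi μ).real {x | countAbove p S x < m}
      = ∑ j ∈ Finset.range m, successWeight (fun i => (μ i).real (Set.Ioi p)) S j := by
  classical
  induction S using Finset.induction_on generalizing m with
  | empty =>
    rcases m with _ | m
    · simp
    · simp [countAbove, successWeight_empty]
  | insert a S ha ih =>
    rcases m with _ | m
    · simp
    have hIoi : MeasurableSet {x : ι → ℝ | x a ∈ Set.Ioi p} :=
      measurable_pi_apply a measurableSet_Ioi
    have hsplit := measureReal_inter_add_sdiff (μ := Measure.pi μ)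
      (s := {x : ι → ℝ | countAbove p (insert a S) x < m + 1}) hIoi
    have hi := indepFun_eval_countAbove μ p ha
    have e1 : {x : ι → ℝ | countAbove p (insert a S) x < m + 1} ∩ {x | x a ∈ Set.Ioi p}
        = (fun x : ι → ℝ => x a) ⁻¹' Set.Ioi p ∩ countAbove p S ⁻¹' Set.Iio m := by
      ext x
      simp only [countAbove_insert p ha, Set.mem_inter_iff, Set.mem_ofPred_eq, Set.mem_Ioi,
        Set.mem_preimage, Set.mem_Iio]
      by_cases h : p < x a <;> simp [h]
    have e2 : {x : ι → ℝ | countAbove p (insert a S) x < m + 1} \ {x | x a ∈ Set.Ioi p}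
        = (fun x : ι → ℝ => x a) ⁻¹' Set.Iic p ∩ countAbove p S ⁻¹' Set.Iio (m + 1) := by
      ext x
      simp only [countAbove_insert p ha, Set.mem_sdiff, Set.mem_inter_iff, Set.mem_ofPred_eq,
        Set.mem_Ioi, Set.mem_preimage, Set.mem_Iio, Set.mem_Iic]
      by_cases h : p < x a
      · simp [h]
      · simp [h, not_lt.1 h]
    have em : ∀ {s : Set ℝ}, MeasurableSet s →
        (Measure.pi μ).real ((fun x : ι → ℝ => x a) ⁻¹' s) = (μ a).real s := fun hs =>
      (measurePreserving_eval μ a).measureReal_preimage hs.nullMeasurableSet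
    have e3 : (μ a).real (Set.Iic p) = 1 - (μ a).real (Set.Ioi p) := by
      rw [← Set.compl_Ioi, probReal_compl_eq_one_sub measurableSet_Ioi]
    rw [← hsplit, e1, e2, measureReal_def, measureReal_def,
      hi.measure_inter_preimage_eq_mul _ _ measurableSet_Ioi measurableSet_Iio,
      hi.measure_inter_preimage_eq_mul _ _ measurableSet_Iic measurableSet_Iio,
      ENNReal.toReal_mul, ENNReal.toReal_mul, ← measureReal_def, ← measureReal_def,
      ← measureReal_def, ← measureReal_def, em measurableSet_Ioi, em measurableSet_Iic, e3,
      sum_successWeight_insert _ ha]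
    have i1 := ih m
    have i2 := ih (m + 1)
    simp only [Set.preimage, Set.mem_Iio] at i1 i2 ⊢
    rw [i1, i2]
    ring

/-- The demand of the other buyers is independent of the value of `a`, so the expectation factors.
-/
lemma integral_eval_mul_countAbove (p : ℝ) {S : Finset ι} {a : ι} (ha : a ∉ S) (k : ℕ)
    {φ : ℝ → ℝ} (hφ : Measurable φ) :
    ∫ x, φ (x a) * (if countAbove p S x < k then 1 else 0) ∂(Measure.pi μ)
      = (∫ v, φ v ∂(μ a)) * (Measure.pi μ).real {x | countAbove p S x < k} := by
  have hψ : Measurable fun m : ℕ => if m < k then (1 : ℝ) else 0 := measurable_of_countable _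
  have h := ((indepFun_eval_countAbove μ p ha).comp hφ hψ).integral_fun_mul_eq_mul_integral
    (hφ.comp (measurable_pi_apply a)).aestronglyMeasurable
    (hψ.comp (measurable_countAbove p S)).aestronglyMeasurable
  simp only [Function.comp_def] at h
  rw [h]
  congr 1
  · rw [← (measurePreserving_eval μ a).map_eq, integral_map (measurable_pi_apply a).aemeasurable
      hφ.aestronglyMeasurable]
  · have e : (fun x : ι → ℝ => if countAbove p S x < k then (1 : ℝ) else 0)
        = {x | countAbove p S x < k}.indicator fun _ => 1 := by
      ext x; simp [Set.indicator_apply]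
    rw [e, integral_indicator (measurableSet_countAbove_lt p S k)]
    simp

lemma integrable_comp_eval {φ : ℝ → ℝ} {a : ι} (hφ : Integrable φ (μ a)) :
    Integrable (fun x : ι → ℝ => φ (x a)) (Measure.pi μ) :=
  (measurePreserving_eval μ a).integrable_comp_of_integrable hφ

lemma integral_comp_eval {φ : ℝ → ℝ} {a : ι} (hφ : AEStronglyMeasurable φ (μ a)) :
    ∫ x : ι → ℝ, φ (x a) ∂(Measure.pi μ) = ∫ v, φ v ∂(μ a) := by
  rw [← (measurePreserving_eval μ a).map_eq] at hφ ⊢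
  exact (integral_map (measurable_pi_apply a).aemeasurable hφ).symm

end Count

/-! ### Sales on a fixed valuation vector -/

section Sales

variable {n : ℕ} (k : ℕ) (p : ℝ) (x : Fin n → ℝ)

lemma mem_soldTo {i : Fin n} : i ∈ soldTo k p x ↔
    p < x i ∧ countAbove p (Finset.univ.filter (· < i)) x < k := by
  simp [soldTo, countAbove, Finset.filter_filter]

/-- Whatever the set of buyers, the number of items sold is the minimum of the supply and the
demand. -/
lemma card_filter_countAbove_lt (S : Finset (Fin n)) :
    (S.filter fun i => p < x i ∧ countAbove p (S.filter (· < i)) x < k).card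
      = min (countAbove p S x) k := by
  induction S using Finset.induction_on_max with
  | empty => simp [countAbove]
  | insert a S hS ih =>
    have ha : a ∉ S := fun h => lt_irrefl _ (hS a h)
    have e1 : (insert a S).filter (· < a) = S := by
      rw [Finset.filter_insert, if_neg (lt_irrefl a), Finset.filter_true_of_mem hS]
    -- The latest arrival does not affect earlier sales.
    have e2 : ∀ i ∈ S, (insert a S).filter (· < i) = S.filter (· < i) := fun i hi => by
      rw [Finset.filter_insert, if_neg (hS i hi).not_gt]
    rw [Finset.filter_insert, e1, countAbove_insert p ha,
      Finset.filter_congr (q := fun i => p < x i ∧ countAbove p (S.filter (· < i)) x < k)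
        fun i hi => by rw [e2 i hi]]
    split_ifs with h1 h2 h2
    · rw [Finset.card_insert_of_notMem (by simp [ha]), ih]
      omega
    · exact absurd h1.1 h2
    · rw [ih]
      have : ¬ countAbove p S x < k := fun h => h1 ⟨h2, h⟩
      omega
    · rw [ih, add_zero]

lemma welfare_eq_sum : welfare k p x = ∑ i, if p < x i then
    x i * (if countAbove p (Finset.univ.filter (· < i)) x < k then 1 else 0) else 0 := by
  rw [welfare, soldTo, Finset.sum_filter]
  refine Finset.sum_congr rfl fun i _ => ?_
  have := mem_soldTo k p x (i := i)
  simp only [soldTo, Finset.mem_filter, Finset.mem_univ, true_and] at this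
  rw [if_congr this rfl rfl, ite_and]
  split_ifs <;> simp

end Sales

/-! ### A price with the optimal guarantee -/

/-! ### Continuity of the demand distribution in the price -/

section SuccessWeightLimits

variable {ι : Type*}

lemma tendsto_sum_successWeight {α : Type*} {l : Filter α} {q : α → ι → ℝ} {r : ι → ℝ}
    (h : ∀ i, Tendsto (fun t => q t i) l (𝓝 (r i))) (S : Finset ι) (m : ℕ) :
    Tendsto (fun t => ∑ j ∈ Finset.range m, successWeight (q t) S j) l
      (𝓝 (∑ j ∈ Finset.range m, successWeight r S j)) := by
  classical
  induction S using Finset.induction_on generalizing m with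
  | empty => simp only [successWeight_empty]; exact tendsto_const_nhds
  | insert a S ha ih =>
    rcases m with _ | m
    · simp only [Finset.range_zero, Finset.sum_empty]
      exact tendsto_const_nhds
    · simp only [sum_successWeight_insert _ ha]
      exact (((h a).const_sub 1).mul (ih _)).add ((h a).mul (ih _))

lemma sum_successWeight_zero (S : Finset ι) {m : ℕ} (hm : 1 ≤ m) :
    ∑ j ∈ Finset.range m, successWeight (fun _ : ι => 0) S j = 1 := by
  classical
  obtain ⟨m, rfl⟩ : ∃ l, m = l + 1 := ⟨m - 1, by omega⟩
  induction S using Finset.induction_on with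
  | empty => simp [successWeight_empty]
  | insert a S ha ih => rw [sum_successWeight_insert _ ha, ih]; ring

end SuccessWeightLimits

/-- Dominated convergence: the indicators converge except at `p`, a null set because the law is
atomless. -/
lemma tendsto_measureReal_Ioi (ν : Measure ℝ) [IsProbabilityMeasure ν] [NullSingletonClass ν]
    (p : ℝ) : Tendsto (fun t => ν.real (Set.Ioi t)) (𝓝 p) (𝓝 (ν.real (Set.Ioi p))) := by
  have e : ∀ t, ν.real (Set.Ioi t) = ∫ v, (Set.Ioi t).indicator (fun _ => (1 : ℝ)) v ∂ν := by
    intro t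
    rw [integral_indicator measurableSet_Ioi]
    simp
  simp only [e]
  refine continuousAt_of_dominated (bound := fun _ => 1) ?_ ?_ (integrable_const _) ?_
  · exact Eventually.of_forall fun t =>
      (measurable_const.indicator measurableSet_Ioi).aestronglyMeasurable
  · refine Eventually.of_forall fun t => Eventually.of_forall fun v => ?_
    by_cases h : v ∈ Set.Ioi t <;> simp [h]
  · have : ∀ᵐ v ∂ν, v ≠ p := by simp [ae_iff]
    filter_upwards [this] with v hv
    rcases lt_or_gt_of_ne hv with h | h
    · refine (continuousAt_const (y := (0 : ℝ))).congr ?_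
      filter_upwards [eventually_gt_nhds h] with t ht
      simp [ht.le]
    · refine (continuousAt_const (y := (1 : ℝ))).congr ?_
      filter_upwards [eventually_lt_nhds h] with t ht
      simp [ht]

lemma tendsto_measureReal_Ioi_atTop (ν : Measure ℝ) [IsProbabilityMeasure ν] :
    Tendsto (fun t => ν.real (Set.Ioi t)) atTop (𝓝 0) := by
  have h := (tendsto_cdf_atTop ν).const_sub 1
  rw [sub_self] at h
  refine h.congr fun t => ?_
  rw [cdf_eq_real, ← Set.compl_Iic, probReal_compl_eq_one_sub measurableSet_Iic]

lemma prophetWelfare_nonneg {n : ℕ} (k : ℕ) (x : Fin n → ℝ) : 0 ≤ prophetWelfare k x :=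
  Finset.le_sup'_of_le _ (b := ∅) (by simp) (by simp)

lemma sum_le_prophetWelfare {n : ℕ} {k : ℕ} (x : Fin n → ℝ) {S : Finset (Fin n)}
    (hS : S.card ≤ k) : ∑ i ∈ S, x i ≤ prophetWelfare k x :=
  Finset.le_sup' (fun S => ∑ i ∈ S, x i) (by simpa using hS)

/-- Each of the at most `k` winners is charged `p` plus an excess, and the excesses are then summed
over all buyers. -/
lemma prophetWelfare_le {n : ℕ} (k : ℕ) {p : ℝ} (hp : 0 ≤ p) (x : Fin n → ℝ) :
    prophetWelfare k x ≤ k * p + ∑ i, max (x i - p) 0 := by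
  refine Finset.sup'_le _ _ fun S hS => ?_
  have hS' : (S.card : ℝ) ≤ k := by exact_mod_cast (Finset.mem_filter.1 hS).2
  calc ∑ i ∈ S, x i ≤ ∑ i ∈ S, (p + max (x i - p) 0) :=
        Finset.sum_le_sum fun i _ => by linarith [le_max_left (x i - p) 0]
    _ = S.card * p + ∑ i ∈ S, max (x i - p) 0 := by
        rw [Finset.sum_add_distrib, Finset.sum_const, nsmul_eq_mul]
    _ ≤ k * p + ∑ i, max (x i - p) 0 :=
        add_le_add (mul_le_mul_of_nonneg_right hS' hp)
          (Finset.sum_le_sum_of_subset_of_nonneg (Finset.subset_univ S)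
            fun _ _ _ => le_max_right _ _)

/-- Revenue plus surplus: each item sold brings `p`, and its buyer keeps the excess over `p`. -/
lemma welfare_eq_add {n : ℕ} (k : ℕ) (p : ℝ) (x : Fin n → ℝ) :
    welfare k p x = p * min (countAbove p Finset.univ x : ℝ) k + ∑ i, max (x i - p) 0 *
      (if countAbove p (Finset.univ.filter (· < i)) x < k then 1 else 0) := by
  have h : min (countAbove p Finset.univ x : ℝ) k = ∑ i,
      if p < x i ∧ countAbove p (Finset.univ.filter (· < i)) x < k then (1 : ℝ) else 0 := by
    rw [← Nat.cast_min, ← card_filter_countAbove_lt, Finset.card_filter]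
    push_cast
    rfl
  rw [h, welfare_eq_sum, Finset.mul_sum, ← Finset.sum_add_distrib]
  refine Finset.sum_congr rfl fun i _ => ?_
  rw [ite_and]
  split_ifs with h1 h2
  · rw [max_eq_left (by linarith)]; ring
  · simp
  · rw [max_eq_right (by linarith)]; ring
  · simp

/-! ### Expected guarantee of a price -/

section Guarantee

variable {n : ℕ} (D : ValuationProfile n)

instance (i : Fin n) : IsProbabilityMeasure (D.law i) := D.isProbabilityMeasure i

instance (i : Fin n) : NullSingletonClass (D.law i) := D.noAtoms i

lemma ValuationProfile.joint_eq : D.joint = Measure.pi D.law := rfl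

instance : IsProbabilityMeasure D.joint := by rw [D.joint_eq]; infer_instance

lemma ValuationProfile.ae_pos : ∀ᵐ x ∂D.joint, ∀ i, 0 < x i := by
  rw [ae_all_iff]
  intro i
  have h : ∀ᵐ v ∂(D.law i), 0 < v := by
    have h0 : ∀ᵐ v ∂(D.law i), v ≠ 0 := by simp [ae_iff]
    filter_upwards [D.nonneg i, h0] with v h1 h2
    exact lt_of_le_of_ne h1 h2.symm
  exact (measurePreserving_eval D.law i).quasiMeasurePreserving.ae h

lemma ValuationProfile.integrable_eval (i : Fin n) : Integrable (fun x => x i) D.joint :=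
  integrable_comp_eval D.law (φ := fun v => v) (D.integrable i)

lemma ValuationProfile.integrable_excess (p : ℝ) (i : Fin n) :
    Integrable (fun v => max (v - p) 0) (D.law i) :=
  ((D.integrable i).sub (integrable_const p)).pos_part

/-- The event that an item is left for buyer `i` is independent of `x i` and contains the event that
fewer than `k` buyers in total exceed the price. -/
lemma le_integral_welfare (k : ℕ) (p : ℝ) :
    p * (k - ∑ i ∈ Finset.range k, D.joint.real {x | countAbove p Finset.univ x < i + 1})
      + D.joint.real {x | countAbove p Finset.univ x < k}
        * ∑ i, ∫ v, max (v - p) 0 ∂(D.law i) ≤ ∫ x, welfare k p x ∂D.joint := by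
  have hφ : Measurable fun v : ℝ => max (v - p) 0 := by fun_prop
  have hind : ∀ i : Fin n, Measurable fun x : Fin n → ℝ =>
      if countAbove p (Finset.univ.filter (· < i)) x < k then (1 : ℝ) else 0 := fun i =>
    Measurable.ite (measurableSet_countAbove_lt _ _ _) measurable_const measurable_const
  have hI : ∀ i : Fin n, Integrable (fun x : Fin n → ℝ => max (x i - p) 0 *
      (if countAbove p (Finset.univ.filter (· < i)) x < k then 1 else 0)) D.joint := fun i => by
    refine (integrable_comp_eval D.law (D.integrable_excess p i)).mul_bdd (c := 1)
      (hind i).aestronglyMeasurable (Eventually.of_forall fun x => ?_)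
    split_ifs <;> simp
  have hmin : Integrable (fun x : Fin n → ℝ => min (countAbove p Finset.univ x : ℝ) k)
      D.joint := by
    refine Integrable.of_bound (C := k) (Measurable.aestronglyMeasurable ?_)
      (Eventually.of_forall fun x => ?_)
    · exact (measurable_from_nat.comp (measurable_countAbove p _)).min measurable_const
    · rw [Real.norm_of_nonneg (by positivity)]
      exact min_le_right _ _
  simp only [welfare_eq_add]
  rw [integral_add (hmin.const_mul p) (integrable_finsetSum _ fun i _ => hI i),
    integral_const_mul, integral_min_eq_sub_sum D.joint (measurable_countAbove p _),
    integral_finsetSum _ fun i _ => hI i, Finset.mul_sum]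
  refine add_le_add le_rfl (Finset.sum_le_sum fun i _ => ?_)
  rw [D.joint_eq, integral_eval_mul_countAbove D.law p (by simp) k hφ, mul_comm]
  refine mul_le_mul_of_nonneg_left ?_ (integral_nonneg fun v => le_max_right _ _)
  exact measureReal_mono fun x hx =>
    lt_of_le_of_lt (countAbove_mono p (Finset.filter_subset _ _) x) hx

lemma integral_prophetWelfare_le (k : ℕ) {p : ℝ} (hp : 0 ≤ p) :
    ∫ x, prophetWelfare k x ∂D.joint ≤ k * p + ∑ i, ∫ v, max (v - p) 0 ∂(D.law i) := by
  have hI : ∀ i : Fin n, Integrable (fun x : Fin n → ℝ => max (x i - p) 0) D.joint := fun i =>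
    integrable_comp_eval D.law (D.integrable_excess p i)
  refine (integral_mono_of_nonneg (Eventually.of_forall fun x => prophetWelfare_nonneg k x)
    ((integrable_const (k * p)).add (integrable_finsetSum _ fun i _ => hI i))
    (Eventually.of_forall fun x => prophetWelfare_le k hp x)).trans_eq ?_
  simp only [Pi.add_apply]
  rw [integral_add (integrable_const _) (integrable_finsetSum _ fun i _ => hI i),
    integral_finsetSum _ fun i _ => hI i]
  congr 1
  · simp
  · refine Finset.sum_congr rfl fun i _ => ?_
    exact integral_comp_eval D.law (D.integrable_excess p i).aestronglyMeasurable

/-- By continuity in the price. At price zero all `n ≥ k` buyers almost surely want an item, so the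
probability is 0; it tends to 1 at infinity. -/
lemma exists_price_countAbove {k : ℕ} (hk : 1 ≤ k) (hkn : k ≤ n) {r : ℝ} (hr0 : 0 < r)
    (hr1 : r < 1) :
    ∃ p : ℝ, 0 ≤ p ∧ D.joint.real {x | countAbove p Finset.univ x < k} = r := by
  let G : ℝ → ℝ := fun p => D.joint.real {x | countAbove p Finset.univ x < k}
  have hG : G = fun p => ∑ j ∈ Finset.range k,
      successWeight (fun i => (D.law i).real (Set.Ioi p)) Finset.univ j :=
    funext fun p => measureReal_countAbove_lt D.law p Finset.univ k
  have hc : Continuous G := by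
    rw [hG, continuous_iff_continuousAt]
    exact fun p => tendsto_sum_successWeight (fun i => tendsto_measureReal_Ioi (D.law i) p) _ _
  have ht : Tendsto G atTop (𝓝 1) := by
    rw [hG, ← sum_successWeight_zero (Finset.univ : Finset (Fin n)) hk]
    exact tendsto_sum_successWeight (fun i => tendsto_measureReal_Ioi_atTop (D.law i)) _ _
  have h0 : G 0 = 0 := by
    have : {x : Fin n → ℝ | countAbove 0 Finset.univ x < k} ⊆ {x | ¬ ∀ i, 0 < x i} := by
      intro x hx hpos
      have : countAbove 0 Finset.univ x = n := by
        simp [countAbove, Finset.filter_true_of_mem fun i _ => hpos i]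
      have hx' : countAbove 0 Finset.univ x < k := hx
      omega
    have h := measure_mono_null this (ae_iff.1 D.ae_pos)
    simp only [G, measureReal_def, h, ENNReal.toReal_zero]
  obtain ⟨b, hb, hb0⟩ := ((ht.eventually_const_lt hr1).and (eventually_ge_atTop 0)).exists
  obtain ⟨p, hp, hpr⟩ := intermediate_value_Icc hb0 hc.continuousOn
    (show r ∈ Set.Icc _ _ from ⟨by rw [h0]; exact hr0.le, hb.le⟩)
  exact ⟨p, hp.1, hpr⟩

/-- With more items than buyers, price zero serves everybody. -/
lemma integral_prophetWelfare_le_welfare_zero {k : ℕ} (hnk : n < k) :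
    ∫ x, prophetWelfare k x ∂D.joint ≤ ∫ x, welfare k 0 x ∂D.joint := by
  have e : ∀ᵐ x ∂D.joint, welfare k 0 x = ∑ i, x i := by
    filter_upwards [D.ae_pos] with x hx
    rw [welfare_eq_sum]
    refine Finset.sum_congr rfl fun i _ => ?_
    have : countAbove 0 (Finset.univ.filter (· < i)) x < k := by
      refine lt_of_le_of_lt (Finset.card_le_univ _) ?_
      simpa using hnk
    rw [if_pos (hx i), if_pos this, mul_one]
  rw [integral_congr_ae e]
  refine integral_mono_of_nonneg (Eventually.of_forall fun x => prophetWelfare_nonneg k x)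
    (integrable_finsetSum _ fun i _ => D.integrable_eval i) ?_
  filter_upwards [D.ae_pos] with x hx
  exact Finset.sup'_le _ _ fun S _ =>
    Finset.sum_le_sum_of_subset_of_nonneg (Finset.subset_univ S) fun i _ _ => (hx i).le

/-- At the tuned price, both the revenue and the surplus in `le_integral_welfare` are at least ρ
times their counterparts in `integral_prophetWelfare_le`. -/
theorem exists_price_balancedRatio {k : ℕ} (hk : 1 ≤ k) : ∃ p : ℝ,
    balancedRatio k * ∫ x, prophetWelfare k x ∂D.joint ≤ ∫ x, welfare k p x ∂D.joint := by
  have hr0 := balancedRatio_pos hk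
  have hr1 := balancedRatio_lt_one hk
  rcases lt_or_ge n k with hnk | hkn
  · refine ⟨0, le_trans ?_ (integral_prophetWelfare_le_welfare_zero D hnk)⟩
    exact mul_le_of_le_one_left (integral_nonneg fun x => prophetWelfare_nonneg k x) hr1.le
  obtain ⟨p, hp, hpr⟩ := exists_price_countAbove D hk hkn hr0 hr1
  refine ⟨p, le_trans ?_ (le_integral_welfare D k p)⟩
  have hsum : ∑ i ∈ Finset.range k, D.joint.real {x | countAbove p Finset.univ x < i + 1}
      ≤ k - k * balancedRatio k := by
    rw [← sum_poissonBelow_balancedRate hk]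
    refine Finset.sum_le_sum fun i hi => ?_
    rw [D.joint_eq, measureReal_countAbove_lt]
    rw [D.joint_eq, measureReal_countAbove_lt] at hpr
    exact sum_successWeight_le_poissonBelow (fun i => measureReal_nonneg)
      (fun i => measureReal_le_one) _ (balancedRate_pos hk) hpr.le (Finset.mem_range.1 hi)
  rw [hpr]
  have h1 := mul_le_mul_of_nonneg_left (integral_prophetWelfare_le D k hp) hr0.le
  have h2 := mul_le_mul_of_nonneg_left hsum hp
  linarith

end Guarantee

/-! ### Binomial sales -/

/-- The probability that a binomial variable with `n` trials equals `j`. -/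
noncomputable def binomialWeight (n j : ℕ) (q : ℝ) : ℝ := n.choose j * q ^ j * (1 - q) ^ (n - j)

/-- The probability that a binomial variable with `n` trials is smaller than `i`. -/
noncomputable def binomialBelow (n i : ℕ) (q : ℝ) : ℝ :=
  ∑ j ∈ Finset.range i, binomialWeight n j q

lemma binomialWeight_eq_eval (n j : ℕ) (q : ℝ) :
    binomialWeight n j q = (bernsteinPolynomial ℝ n j).eval q := by
  simp [binomialWeight, bernsteinPolynomial]

lemma successWeight_congr {ι : Type*} {q r : ι → ℝ} {S : Finset ι} (h : ∀ i ∈ S, q i = r i)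
    (j : ℕ) : successWeight q S j = successWeight r S j := by
  rw [successWeight, successWeight, Finset.prod_congr rfl fun i hi => by rw [h i hi]]

open Polynomial in
lemma successWeight_const {ι : Type*} (q : ℝ) (S : Finset ι) (j : ℕ) :
    successWeight (fun _ => q) S j = binomialWeight S.card j q := by
  rw [successWeight, Finset.prod_const, add_comm, add_pow, finsetSum_coeff]
  have : ∀ i, (((C q * X) ^ i * C (1 - q) ^ (S.card - i) * (S.card.choose i : ℝ[X])).coeff j)
      = if j = i then binomialWeight S.card i q else 0 := by
    intro i
    have e : (C q * X) ^ i * C (1 - q) ^ (S.card - i) * (S.card.choose i : ℝ[X])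
        = C (binomialWeight S.card i q) * X ^ i := by
      simp only [binomialWeight, mul_pow, map_mul, map_pow, map_natCast]
      ring
    rw [e, coeff_C_mul_X_pow]
  simp only [this]
  rw [Finset.sum_ite_eq]
  split_ifs with h
  · rfl
  · rw [Finset.mem_range, not_lt] at h
    rw [binomialWeight, Nat.choose_eq_zero_of_lt (by omega)]
    simp

lemma binomialWeight_nonneg (n j : ℕ) {q : ℝ} (h0 : 0 ≤ q) (h1 : q ≤ 1) :
    0 ≤ binomialWeight n j q := by
  have : 0 ≤ 1 - q := by linarith
  unfold binomialWeight
  positivity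

lemma binomialWeight_pos {n j : ℕ} (hj : j ≤ n) {q : ℝ} (h0 : 0 < q) (h1 : q < 1) :
    0 < binomialWeight n j q := by
  have : 0 < 1 - q := by linarith
  have := Nat.choose_pos hj
  unfold binomialWeight
  positivity

lemma binomialBelow_succ (n i : ℕ) (q : ℝ) :
    binomialBelow n (i + 1) q = binomialBelow n i q + binomialWeight n i q :=
  Finset.sum_range_succ _ _

lemma hasDerivAt_binomialBelow (n i : ℕ) (q : ℝ) :
    HasDerivAt (binomialBelow (n + 1) (i + 1)) (-((n + 1) * binomialWeight n i q)) q := by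
  have hw : ∀ j, binomialWeight (n + 1) j = fun q => (bernsteinPolynomial ℝ (n + 1) j).eval q :=
    fun j => funext fun q => binomialWeight_eq_eval _ _ _
  induction i with
  | zero =>
    have e : binomialBelow (n + 1) (0 + 1) = binomialWeight (n + 1) 0 := by
      ext; simp [binomialBelow]
    rw [e, hw]
    refine ((bernsteinPolynomial ℝ (n + 1) 0).hasDerivAt q).congr_deriv ?_
    rw [bernsteinPolynomial.derivative_zero, binomialWeight_eq_eval]
    simp
    ring
  | succ i ih =>
    have e : binomialBelow (n + 1) (i + 1 + 1)
        = binomialBelow (n + 1) (i + 1) + binomialWeight (n + 1) (i + 1) := by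
      ext y; exact binomialBelow_succ _ _ _
    rw [e, hw]
    refine (ih.add ((bernsteinPolynomial ℝ (n + 1) (i + 1)).hasDerivAt q)).congr_deriv ?_
    rw [bernsteinPolynomial.derivative_succ, binomialWeight_eq_eval]
    simp [binomialWeight_eq_eval]
    ring

/-- The ratio `P(N ≤ m) / P(N = m)` of a binomial variable decreases in the success probability. -/
lemma binomialBelow_mul_le {n m : ℕ} (hm : m ≤ n) {q r : ℝ} (hq : 0 ≤ q) (hqr : q ≤ r)
    (hr : r ≤ 1) : binomialBelow n (m + 1) r * binomialWeight n m q
      ≤ binomialBelow n (m + 1) q * binomialWeight n m r := by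
  rw [binomialBelow, binomialBelow, Finset.sum_mul, Finset.sum_mul]
  refine Finset.sum_le_sum fun j hj => ?_
  have hjm : j ≤ m := Nat.lt_succ_iff.1 (Finset.mem_range.1 hj)
  have hq1 : 0 ≤ 1 - q := by linarith
  have hr1 : 0 ≤ 1 - r := by linarith
  have hr0 : 0 ≤ r := by linarith
  obtain ⟨d, rfl⟩ := Nat.exists_eq_add_of_le hjm
  have e : n - j = (n - (j + d)) + d := by omega
  -- The comparison holds term by term: with `d = m - j`, it reduces to the monotonicity of the
  -- odds, raised to the power `d`.
  have h := pow_le_pow_left₀ (by positivity) (show (1 - r) * q ≤ (1 - q) * r by nlinarith) d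
  have h' := mul_le_mul_of_nonneg_left h (show 0 ≤ n.choose j * n.choose (j + d) *
    (q * r) ^ j * ((1 - q) * (1 - r)) ^ (n - (j + d)) by positivity)
  rw [mul_pow, mul_pow, mul_pow, mul_pow] at h'
  simp only [binomialWeight, e, pow_add]
  refine le_trans (le_of_eq ?_) (h'.trans (le_of_eq ?_)) <;> ring

/-- The Lagrangian of the two guarantees of a static price with `n` identical buyers. -/
noncomputable def binomialTradeoff (n k : ℕ) (W q : ℝ) : ℝ :=
  k - ∑ i ∈ Finset.range k, binomialBelow n (i + 1) q + W * binomialBelow n k q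

/-- The sum of the derivatives is again a distribution function, so the derivative vanishes exactly
when `W` is P(N ≤ m)/P(N = m) for `n` trials, where this is defined. -/
lemma hasDerivAt_binomialTradeoff (n m : ℕ) (W q : ℝ) :
    HasDerivAt (binomialTradeoff (n + 1) (m + 1) W)
      ((n + 1) * (binomialBelow n (m + 1) q - W * binomialWeight n m q)) q := by
  have h1 : HasDerivAt (fun q => ∑ i ∈ Finset.range (m + 1), binomialBelow (n + 1) (i + 1) q)
      (∑ i ∈ Finset.range (m + 1), -((n + 1) * binomialWeight n i q)) q :=
    HasDerivAt.fun_sum fun i _ => hasDerivAt_binomialBelow n i q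
  refine ((h1.const_sub ((m + 1 : ℕ) : ℝ)).add
    ((hasDerivAt_binomialBelow n m q).const_mul W)).congr_deriv ?_
  rw [Finset.sum_neg_distrib, ← Finset.mul_sum, binomialBelow]
  ring

/-- With the right multiplier, a given success probability maximizes the Lagrangian. -/
lemma binomialTradeoff_le {n m : ℕ} (hm : m ≤ n) {r : ℝ} (hr0 : 0 < r) (hr1 : r < 1) {q : ℝ}
    (hq0 : 0 ≤ q) (hq1 : q ≤ 1) :
    binomialTradeoff (n + 1) (m + 1) (binomialBelow n (m + 1) r / binomialWeight n m r) q
      ≤ binomialTradeoff (n + 1) (m + 1) (binomialBelow n (m + 1) r / binomialWeight n m r) r := by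
  set W := binomialBelow n (m + 1) r / binomialWeight n m r with hW
  have hpos := binomialWeight_pos hm hr0 hr1
  have hd := hasDerivAt_binomialTradeoff n m W
  have hc : ∀ s, ContinuousOn (binomialTradeoff (n + 1) (m + 1) W) s := fun s t _ =>
    (hd t).continuousAt.continuousWithinAt
  -- By `binomialBelow_mul_le` that ratio decreases, so the tradeoff increases up to `r` and
  -- decreases after it.
  rcases le_total q r with h | h
  · refine monotoneOn_of_deriv_nonneg (convex_Icc 0 r) (hc _)
      (fun t _ => (hd t).differentiableAt.differentiableWithinAt) (fun t ht => ?_)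
      (Set.mem_Icc.2 ⟨hq0, h⟩) (Set.right_mem_Icc.2 hr0.le) h
    rw [interior_Icc] at ht
    rw [(hd t).deriv]
    refine mul_nonneg (by positivity) (sub_nonneg.2 ?_)
    rw [hW, div_mul_eq_mul_div, div_le_iff₀ hpos]
    exact binomialBelow_mul_le hm ht.1.le ht.2.le hr1.le
  · refine antitoneOn_of_deriv_nonpos (convex_Icc r 1) (hc _)
      (fun t _ => (hd t).differentiableAt.differentiableWithinAt) (fun t ht => ?_)
      (Set.left_mem_Icc.2 hr1.le) (Set.mem_Icc.2 ⟨h, hq1⟩) h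
    rw [interior_Icc] at ht
    rw [(hd t).deriv]
    refine mul_nonpos_of_nonneg_of_nonpos (by positivity) (sub_nonpos.2 ?_)
    rw [hW, div_mul_eq_mul_div, le_div_iff₀ hpos]
    exact binomialBelow_mul_le hm hr0.le ht.1.le ht.2.le

lemma tendsto_binomialWeight {q : ℕ → ℝ} {x : ℝ} (h : Tendsto (fun n => n * q n) atTop (𝓝 x))
    (j : ℕ) : Tendsto (fun n => binomialWeight n j (q n)) atTop (𝓝 (poissonWeight j x)) :=
  tendsto_choose_mul_pow_of_tendsto_mul_atTop j h

lemma tendsto_binomialBelow {q : ℕ → ℝ} {x : ℝ} (h : Tendsto (fun n => n * q n) atTop (𝓝 x))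
    (i : ℕ) : Tendsto (fun n => binomialBelow n i (q n)) atTop (𝓝 (poissonBelow i x)) :=
  tendsto_finsetSum _ fun j _ => tendsto_binomialWeight h j

/-! ### Profiles on which no static price does better -/

section HardProfile

lemma integral_restrict_Icc_le {a b : ℝ} (hab : a ≤ b) {f : ℝ → ℝ} (hf : Continuous f) {C : ℝ}
    (hC : ∀ v ∈ Set.Icc a b, f v ≤ C) : ∫ v in Set.Icc a b, f v ≤ (b - a) * C := by
  have h := setIntegral_mono_on (μ := volume) (hf.continuousOn.integrableOn_Icc (a := a) (b := b))
    (integrableOn_const (C := C) (by simp)) measurableSet_Icc hC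
  simpa [hab] using h

lemma le_integral_restrict_Icc {a b : ℝ} (hab : a ≤ b) {f : ℝ → ℝ} (hf : Continuous f) {C : ℝ}
    (hC : ∀ v ∈ Set.Icc a b, C ≤ f v) : (b - a) * C ≤ ∫ v in Set.Icc a b, f v := by
  have h := setIntegral_mono_on (μ := volume) (integrableOn_const (C := C) (by simp))
    (hf.continuousOn.integrableOn_Icc (a := a) (b := b)) measurableSet_Icc hC
  simpa [hab] using h

/-- The valuation of a typical buyer: almost deterministic, about `M`. -/
noncomputable def typicalLaw (M : ℝ) : Measure ℝ := volume.restrict (Set.Icc M (M + 1))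

/-- The valuation of a special buyer: negligible compared to `M`, except for a valuation of about
`W * M ^ 2` with probability `M⁻¹`. -/
noncomputable def specialLaw (M W : ℝ) : Measure ℝ :=
  -- The density is one, so the lengths `1 - M⁻¹` and `M⁻¹` are the probabilities.
  volume.restrict (Set.Icc 0 (1 - M⁻¹)) + volume.restrict (Set.Icc (W * M ^ 2) (W * M ^ 2 + M⁻¹))

variable {M W : ℝ}

instance : IsProbabilityMeasure (typicalLaw M) := ⟨by simp [typicalLaw]⟩

instance : NullSingletonClass (typicalLaw M) := by unfold typicalLaw; infer_instance

instance : NullSingletonClass (specialLaw M W) := ⟨fun x => by simp [specialLaw]⟩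

lemma isProbabilityMeasure_specialLaw (hM : 1 ≤ M) : IsProbabilityMeasure (specialLaw M W) := by
  have h0 : 0 ≤ M⁻¹ := by positivity
  have h1 : M⁻¹ ≤ 1 := inv_le_one_of_one_le₀ hM
  constructor
  simp only [specialLaw, Measure.add_apply, Measure.restrict_apply_univ, Real.volume_Icc]
  rw [← ENNReal.ofReal_add (by linarith) (by linarith)]
  simp

lemma ae_typicalLaw : ∀ᵐ v ∂(typicalLaw M), v ∈ Set.Icc M (M + 1) :=
  ae_restrict_mem measurableSet_Icc

lemma ae_specialLaw (hW : 0 ≤ W) : ∀ᵐ v ∂(specialLaw M W), 0 ≤ v := by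
  rw [specialLaw, ae_add_measure_iff]
  constructor
  · filter_upwards [ae_restrict_mem measurableSet_Icc] with v hv using hv.1
  · filter_upwards [ae_restrict_mem measurableSet_Icc] with v hv
    exact le_trans (by positivity) hv.1

lemma integrable_typicalLaw {f : ℝ → ℝ} (hf : Continuous f) : Integrable f (typicalLaw M) :=
  hf.continuousOn.integrableOn_Icc

lemma integrable_specialLaw {f : ℝ → ℝ} (hf : Continuous f) : Integrable f (specialLaw M W) :=
  integrable_add_measure.2
    ⟨hf.continuousOn.integrableOn_Icc, hf.continuousOn.integrableOn_Icc⟩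

lemma integral_specialLaw {f : ℝ → ℝ} (hf : Continuous f) :
    ∫ v, f v ∂(specialLaw M W) = (∫ v in Set.Icc 0 (1 - M⁻¹), f v)
      + ∫ v in Set.Icc (W * M ^ 2) (W * M ^ 2 + M⁻¹), f v :=
  integral_add_measure hf.continuousOn.integrableOn_Icc hf.continuousOn.integrableOn_Icc

lemma integral_id_specialLaw_le (hM : 1 ≤ M) : ∫ v, v ∂(specialLaw M W) ≤ 1 + W * M := by
  have h0 : 0 < M⁻¹ := by positivity
  have h1 : M⁻¹ ≤ 1 := inv_le_one_of_one_le₀ hM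
  rw [integral_specialLaw continuous_id']
  have i1 := integral_restrict_Icc_le (show 0 ≤ 1 - M⁻¹ by linarith) continuous_id' (C := 1)
    fun v hv => by linarith [hv.2]
  have i2 := integral_restrict_Icc_le (show W * M ^ 2 ≤ W * M ^ 2 + M⁻¹ by linarith) continuous_id'
    (C := W * M ^ 2 + M⁻¹) fun v hv => hv.2
  have e : (W * M ^ 2 + M⁻¹ - W * M ^ 2) * (W * M ^ 2 + M⁻¹) = W * M + M⁻¹ * M⁻¹ := by
    field_simp
    ring
  nlinarith

lemma le_integral_max_specialLaw (hM : 1 ≤ M) :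
    M - 1 + W * M ≤ ∫ v, max M v ∂(specialLaw M W) := by
  have h0 : 0 < M⁻¹ := by positivity
  have h1 : M⁻¹ ≤ 1 := inv_le_one_of_one_le₀ hM
  have hc : Continuous fun v : ℝ => max M v := by fun_prop
  rw [integral_specialLaw hc]
  have i1 := le_integral_restrict_Icc (show 0 ≤ 1 - M⁻¹ by linarith) hc (C := M)
    fun v hv => le_max_left _ _
  have i2 := le_integral_restrict_Icc (show W * M ^ 2 ≤ W * M ^ 2 + M⁻¹ by linarith) hc
    (C := W * M ^ 2) fun v hv => hv.1.trans (le_max_right _ _)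
  have e : (W * M ^ 2 + M⁻¹ - W * M ^ 2) * (W * M ^ 2) = W * M := by
    field_simp
    ring
  have e' : (1 - M⁻¹ - 0) * M = M - 1 := by
    field_simp
    ring
  linarith

/-- `n` typical buyers followed by a special one. -/
noncomputable def hardProfile (n : ℕ) (hM : 1 ≤ M) (hW : 0 ≤ W) : ValuationProfile (n + 1) where
  law i := if i = Fin.last n then specialLaw M W else typicalLaw M
  isProbabilityMeasure i := by
    have := isProbabilityMeasure_specialLaw (W := W) hM
    split_ifs <;> infer_instance
  noAtoms i := by split_ifs <;> infer_instance
  nonneg i := by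
    split_ifs
    · exact ae_specialLaw hW
    · filter_upwards [ae_typicalLaw] with v hv
      linarith [hv.1]
  integrable i := by
    split_ifs
    · exact integrable_specialLaw continuous_id'
    · exact integrable_typicalLaw continuous_id'

/-- The buyers before the last one. -/
def earlyBuyers (n : ℕ) : Finset (Fin (n + 1)) := Finset.univ.filter (· < Fin.last n)

lemma last_notMem_earlyBuyers (n : ℕ) : Fin.last n ∉ earlyBuyers n := by simp [earlyBuyers]

lemma insert_last_earlyBuyers (n : ℕ) : insert (Fin.last n) (earlyBuyers n) = Finset.univ := by
  ext i
  simpa [earlyBuyers] using (Fin.le_last i).eq_or_lt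

lemma card_earlyBuyers (n : ℕ) : (earlyBuyers n).card = n := by
  have h := Finset.card_insert_of_notMem (last_notMem_earlyBuyers n)
  rw [insert_last_earlyBuyers, Finset.card_univ, Fintype.card_fin] at h
  omega

variable {n : ℕ} (hM : 1 ≤ M) (hW : 0 ≤ W)

lemma hardProfile_law_last : (hardProfile n hM hW).law (Fin.last n) = specialLaw M W := if_pos rfl

lemma hardProfile_law_early {i : Fin (n + 1)} (hi : i ∈ earlyBuyers n) :
    (hardProfile n hM hW).law i = typicalLaw M :=
  if_neg fun h : i = Fin.last n => last_notMem_earlyBuyers n (h ▸ hi)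

lemma ae_hardProfile : ∀ᵐ x ∂(hardProfile n hM hW).joint,
    0 ≤ x (Fin.last n) ∧ ∀ i ∈ earlyBuyers n, x i ∈ Set.Icc M (M + 1) := by
  refine Eventually.and ?_ ?_
  · filter_upwards [(hardProfile n hM hW).ae_pos] with x hx using (hx _).le
  · rw [Finset.eventually_all]
    intro i hi
    have h := ae_typicalLaw (M := M)
    rw [← hardProfile_law_early hM hW hi] at h
    exact (measurePreserving_eval (hardProfile n hM hW).law i).quasiMeasurePreserving.ae h

lemma measureReal_hardProfile (p : ℝ) (m : ℕ) :
    (hardProfile n hM hW).joint.real {x | countAbove p (earlyBuyers n) x < m}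
      = binomialBelow n m ((typicalLaw M).real (Set.Ioi p)) := by
  rw [ValuationProfile.joint_eq, measureReal_countAbove_lt, binomialBelow]
  refine Finset.sum_congr rfl fun j _ => ?_
  rw [successWeight_congr (r := fun _ => (typicalLaw M).real (Set.Ioi p)) fun i hi => by
    rw [hardProfile_law_early hM hW hi], successWeight_const, card_earlyBuyers]

/-- The special buyer comes last and takes no item from the others. Since its value is nonnegative,
its own price test can be dropped. -/
lemma welfare_le_of_typical (k : ℕ) (p : ℝ) {x : Fin (n + 1) → ℝ} (h0 : 0 ≤ x (Fin.last n))
    (hx : ∀ i ∈ earlyBuyers n, x i ≤ M + 1) :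
    welfare k p x ≤ (M + 1) * min (countAbove p (earlyBuyers n) x : ℝ) k
      + x (Fin.last n) * (if countAbove p (earlyBuyers n) x < k then 1 else 0) := by
  have hmin : min (countAbove p (earlyBuyers n) x : ℝ) k = ∑ i ∈ earlyBuyers n,
      if p < x i ∧ countAbove p (Finset.univ.filter (· < i)) x < k then (1 : ℝ) else 0 := by
    rw [← Nat.cast_min, ← card_filter_countAbove_lt, Finset.card_filter]
    push_cast
    refine Finset.sum_congr rfl fun i hi => ?_
    have : (earlyBuyers n).filter (· < i) = Finset.univ.filter (· < i) := by
      ext j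
      simp only [earlyBuyers, Finset.mem_filter, Finset.mem_univ, true_and,
        and_iff_right_iff_imp]
      exact fun h => h.trans_le (Fin.le_last i)
    rw [this]
  rw [hmin, welfare_eq_sum, ← insert_last_earlyBuyers n,
    Finset.sum_insert (last_notMem_earlyBuyers n), add_comm, Finset.mul_sum]
  simp only [insert_last_earlyBuyers]
  refine add_le_add (Finset.sum_le_sum fun i hi => ?_) ?_
  · have := hx i hi
    rw [ite_and]
    split_ifs <;> linarith
  · change (if p < x (Fin.last n) then x (Fin.last n) *
      (if countAbove p (earlyBuyers n) x < k then 1 else 0) else 0) ≤ _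
    split_ifs <;> simp [h0]

/-- The leading order in `M` is `M * binomialTradeoff n k W q`, with `q` the acceptance probability
of a typical buyer. -/
lemma integral_welfare_hardProfile_le (k : ℕ) (p : ℝ) :
    ∫ x, welfare k p x ∂(hardProfile n hM hW).joint ≤
      (M + 1) * (k - ∑ i ∈ Finset.range k,
        binomialBelow n (i + 1) ((typicalLaw M).real (Set.Ioi p)))
      + (1 + W * M) * binomialBelow n k ((typicalLaw M).real (Set.Ioi p)) := by
  set D := hardProfile n hM hW with hD
  have hnn : 0 ≤ᵐ[D.joint] fun x => welfare k p x := by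
    filter_upwards [D.ae_pos] with x hx
    exact Finset.sum_nonneg fun i _ => (hx i).le
  have hmeas : Measurable fun x : Fin (n + 1) → ℝ =>
      if countAbove p (earlyBuyers n) x < k then (1 : ℝ) else 0 :=
    Measurable.ite (measurableSet_countAbove_lt _ _ _) measurable_const measurable_const
  have hI : Integrable (fun x : Fin (n + 1) → ℝ => x (Fin.last n) *
      (if countAbove p (earlyBuyers n) x < k then 1 else 0)) D.joint := by
    refine (D.integrable_eval (Fin.last n)).mul_bdd (c := 1) hmeas.aestronglyMeasurable
      (Eventually.of_forall fun x => ?_)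
    split_ifs <;> simp
  have hmin : Integrable (fun x : Fin (n + 1) → ℝ =>
      min (countAbove p (earlyBuyers n) x : ℝ) k) D.joint := by
    refine Integrable.of_bound (C := k) (Measurable.aestronglyMeasurable ?_)
      (Eventually.of_forall fun x => ?_)
    · exact (measurable_from_nat.comp (measurable_countAbove p _)).min measurable_const
    · rw [Real.norm_of_nonneg (by positivity)]
      exact min_le_right _ _
  refine (integral_mono_of_nonneg hnn ((hmin.const_mul (M + 1)).add hI) ?_).trans ?_
  · filter_upwards [ae_hardProfile hM hW] with x hx
    exact welfare_le_of_typical k p hx.1 fun i hi => (hx.2 i hi).2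
  · simp only [Pi.add_apply]
    rw [integral_add (hmin.const_mul _) hI, integral_const_mul,
      integral_min_eq_sub_sum D.joint (measurable_countAbove p _)]
    have e := integral_eval_mul_countAbove D.law p (last_notMem_earlyBuyers n) k measurable_id'
    rw [← D.joint_eq] at e
    rw [e]
    simp only [hD, measureReal_hardProfile, hardProfile_law_last]
    refine add_le_add le_rfl (mul_le_mul_of_nonneg_right (integral_id_specialLaw_le hM) ?_)
    rw [← measureReal_hardProfile hM hW]
    exact measureReal_nonneg

/-- The prophet takes `k - 1` typical buyers and then the special one or another typical one,
whichever is better. -/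
lemma le_prophetWelfare_of_typical {k : ℕ} (hk : 1 ≤ k) (hkn : k ≤ n) {x : Fin (n + 1) → ℝ}
    (hx : ∀ i ∈ earlyBuyers n, M ≤ x i) :
    (k - 1) * M + max M (x (Fin.last n)) ≤ prophetWelfare k x := by
  have hsum : ∀ T ⊆ earlyBuyers n, T.card * M ≤ ∑ i ∈ T, x i := fun T hT => by
    rw [← nsmul_eq_mul]
    exact Finset.card_nsmul_le_sum _ _ _ fun i hi => hx i (hT hi)
  rcases le_total M (x (Fin.last n)) with h | h
  · rw [max_eq_right h]
    obtain ⟨T, hT, hTc⟩ := Finset.exists_subset_card_eq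
      (show k - 1 ≤ (earlyBuyers n).card by rw [card_earlyBuyers]; omega)
    have hn : Fin.last n ∉ T := fun h => last_notMem_earlyBuyers n (hT h)
    have h1 := sum_le_prophetWelfare (k := k) x (S := insert (Fin.last n) T)
      (by rw [Finset.card_insert_of_notMem hn]; omega)
    rw [Finset.sum_insert hn] at h1
    have h2 := hsum T hT
    rw [hTc, Nat.cast_sub hk, Nat.cast_one] at h2
    linarith
  · rw [max_eq_left h]
    obtain ⟨T, hT, hTc⟩ := Finset.exists_subset_card_eq
      (show k ≤ (earlyBuyers n).card by rw [card_earlyBuyers]; omega)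
    have h1 := sum_le_prophetWelfare (k := k) x (S := T) hTc.le
    have h2 := hsum T hT
    rw [hTc] at h2
    linarith

lemma integrable_prophetWelfare (D : ValuationProfile n) (k : ℕ) :
    Integrable (fun x => prophetWelfare k x) D.joint := by
  have hm : Measurable fun x : Fin n → ℝ => prophetWelfare k x := by
    have hs : (Finset.univ.filter fun S : Finset (Fin n) => S.card ≤ k).Nonempty := ⟨∅, by simp⟩
    have h := Finset.measurable_sup' hs (f := fun S (x : Fin n → ℝ) => ∑ i ∈ S, x i) fun S _ =>
      Finset.measurable_sum _ fun i _ => measurable_pi_apply i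
    convert h using 1
    ext x
    exact (Finset.sup'_apply hs (fun S (x : Fin n → ℝ) => ∑ i ∈ S, x i) x).symm
  refine Integrable.mono' (g := fun x => k * (0 : ℝ) + ∑ i, max (x i - 0) 0) ?_
    hm.aestronglyMeasurable (Eventually.of_forall fun x => ?_)
  · exact (integrable_const _).add (integrable_finsetSum _ fun i _ =>
      integrable_comp_eval D.law (D.integrable_excess 0 i))
  · rw [Real.norm_of_nonneg (prophetWelfare_nonneg k x)]
    exact prophetWelfare_le k le_rfl x

lemma le_integral_prophetWelfare_hardProfile {k : ℕ} (hk : 1 ≤ k) (hkn : k ≤ n) :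
    M * (k + W) - 1 ≤ ∫ x, prophetWelfare k x ∂(hardProfile n hM hW).joint := by
  set D := hardProfile n hM hW with hD
  have hc : Continuous fun v : ℝ => max M v := by fun_prop
  have hi : Integrable (fun v : ℝ => max M v) (D.law (Fin.last n)) := by
    rw [hD, hardProfile_law_last]
    exact integrable_specialLaw hc
  have hi' : Integrable (fun x : Fin (n + 1) → ℝ => max M (x (Fin.last n))) D.joint :=
    integrable_comp_eval D.law hi
  have h := integral_mono_ae ((integrable_const ((k - 1) * M)).add hi')
    (integrable_prophetWelfare D k) (by
      filter_upwards [ae_hardProfile hM hW] with x hx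
      exact le_prophetWelfare_of_typical hk hkn fun i hi => (hx.2 i hi).1)
  simp only [Pi.add_apply] at h
  have e : ∫ x : Fin (n + 1) → ℝ, max M (x (Fin.last n)) ∂D.joint
      = ∫ v, max M v ∂(D.law (Fin.last n)) :=
    integral_comp_eval D.law (φ := fun v => max M v) hi.aestronglyMeasurable
  rw [integral_add (integrable_const _) hi', e, hD, hardProfile_law_last] at h
  simp only [integral_const, probReal_univ, one_smul] at h
  have := le_integral_max_specialLaw (W := W) hM
  linarith

end HardProfile

/-! ### The optimal competitive ratio -/

/-- Randomizing only averages over prices. Nonnegativity makes the comparison valid without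
integrability in `p`. -/
lemma StaticPricing.expectedWelfare_le {k n : ℕ} (σ : StaticPricing) (D : ValuationProfile n)
    {C : ℝ} (hC : ∀ p, ∫ x, welfare k p x ∂D.joint ≤ C) : σ.expectedWelfare k D ≤ C := by
  refine (integral_mono_of_nonneg (Eventually.of_forall fun p => ?_) (integrable_const C)
    (Eventually.of_forall hC)).trans_eq (by simp)
  refine integral_nonneg_of_ae ?_
  filter_upwards [D.ae_pos] with x hx
  exact Finset.sum_nonneg fun i _ => (hx i).le

lemma StaticPricing.IsCompetitive.mul_le_of_binomialTradeoff_le {k n : ℕ} (hk : 1 ≤ k)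
    (hkn : k ≤ n) {σ : StaticPricing} {α : ℝ} (hα : 0 ≤ α) (hσ : σ.IsCompetitive k α) {W H : ℝ}
    (hW : 0 ≤ W) (hH : ∀ q, 0 ≤ q → q ≤ 1 → binomialTradeoff n k W q ≤ H) :
    α * (k + W) ≤ H := by
  have key : ∀ M : ℝ, 1 ≤ M → M * (α * (k + W) - H) ≤ k + 1 + α := by
    intro M hM
    have h1 := mul_le_mul_of_nonneg_left
      (le_integral_prophetWelfare_hardProfile (n := n) hM hW hk hkn) hα
    have h2 := hσ (n + 1) (hardProfile n hM hW)
    have h3 : σ.expectedWelfare k (hardProfile n hM hW) ≤ M * H + k + 1 := by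
      refine σ.expectedWelfare_le _ fun p => (integral_welfare_hardProfile_le hM hW k p).trans ?_
      have hq := hH ((typicalLaw M).real (Set.Ioi p)) measureReal_nonneg measureReal_le_one
      rw [binomialTradeoff] at hq
      have h4 := mul_le_mul_of_nonneg_left hq (by linarith : 0 ≤ M)
      have h5 : binomialBelow n k ((typicalLaw M).real (Set.Ioi p)) ≤ 1 := by
        rw [← measureReal_hardProfile hM hW]
        exact measureReal_le_one
      have h6 : 0 ≤ ∑ i ∈ Finset.range k,
          binomialBelow n (i + 1) ((typicalLaw M).real (Set.Ioi p)) :=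
        Finset.sum_nonneg fun i _ => by
          rw [← measureReal_hardProfile hM hW]
          exact measureReal_nonneg
      linarith
    linarith
  by_contra! h
  have hd : 0 < α * (k + W) - H := by linarith
  have hpos : (0 : ℝ) ≤ k + 1 + α := by positivity
  -- This `M` makes the left side of `key` exceed its right side by `α * (k + W) - H > 0`.
  have h1 := key ((k + 1 + α) / (α * (k + W) - H) + 1) (by
    have : 0 ≤ (k + 1 + α) / (α * (k + W) - H) := by positivity
    linarith)
  rw [add_mul, div_mul_cancel₀ _ hd.ne'] at h1
  linarith

lemma tendsto_mul_div_succ (x : ℝ) :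
    Tendsto (fun n : ℕ => (n : ℝ) * (x / (n + 1))) atTop (𝓝 x) := by
  have h := (tendsto_natCast_div_add_atTop (1 : ℝ)).const_mul x
  rw [mul_one] at h
  exact h.congr fun n => by ring

lemma tendsto_binomialBelow_succ (i : ℕ) (x : ℝ) :
    Tendsto (fun n : ℕ => binomialBelow (n + 1) i (x / (n + 1))) atTop
      (𝓝 (poissonBelow i x)) := by
  have h : Tendsto (fun n : ℕ => (n : ℝ) * (x / n)) atTop (𝓝 x) := by
    refine tendsto_const_nhds.congr' ?_
    filter_upwards [eventually_ge_atTop 1] with n hn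
    have : (n : ℝ) ≠ 0 := by positivity
    field_simp
  refine ((tendsto_binomialBelow h i).comp (tendsto_add_atTop_nat 1)).congr fun n => ?_
  simp

/-- With `n + 1` typical buyers, `W n` makes the acceptance probability `x / (n + 1)` optimal. As
`n` grows, `W n` converges and the binomial laws become Poisson of mean `x`, at which both
guarantees equal ρ; the factor k + W then cancels. -/
theorem StaticPricing.IsCompetitive.le_balancedRatio {k : ℕ} (hk : 1 ≤ k) {σ : StaticPricing}
    {α : ℝ} (hσ : σ.IsCompetitive k α) : α ≤ balancedRatio k := by
  rcases lt_or_ge α 0 with hα | hα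
  · exact hα.le.trans (balancedRatio_pos hk).le
  obtain ⟨m, rfl⟩ : ∃ l, k = l + 1 := ⟨k - 1, by omega⟩
  set x := balancedRate (m + 1) with hx
  have hx0 : 0 < x := balancedRate_pos hk
  have hw := poissonWeight_pos m hx0
  let W : ℕ → ℝ := fun n => binomialBelow n (m + 1) (x / (n + 1)) / binomialWeight n m (x / (n + 1))
  have hWlim : Tendsto W atTop (𝓝 (poissonBelow (m + 1) x / poissonWeight m x)) :=
    (tendsto_binomialBelow (tendsto_mul_div_succ x) _).div
      (tendsto_binomialWeight (tendsto_mul_div_succ x) _) hw.ne'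
  have hev : ∀ᶠ n : ℕ in atTop, α * ((m + 1 : ℕ) + W n)
      ≤ binomialTradeoff (n + 1) (m + 1) (W n) (x / (n + 1)) := by
    filter_upwards [eventually_ge_atTop m,
      tendsto_natCast_atTop_atTop.eventually_gt_atTop x] with n hn hxn
    have h0 : 0 < x / (n + 1) := by positivity
    have h1 : x / (n + 1) < 1 := by
      rw [div_lt_one (by positivity)]
      linarith
    have hW : 0 ≤ W n := div_nonneg
      (Finset.sum_nonneg fun j _ => binomialWeight_nonneg n j h0.le h1.le)
      (binomialWeight_nonneg n m h0.le h1.le)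
    exact hσ.mul_le_of_binomialTradeoff_le hk (by omega) hα hW fun q hq0 hq1 =>
      binomialTradeoff_le hn h0 h1 hq0 hq1
  have hlim := le_of_tendsto_of_tendsto ((hWlim.const_add ((m + 1 : ℕ) : ℝ)).const_mul α)
    (((tendsto_finsetSum (Finset.range (m + 1)) fun i _ =>
      tendsto_binomialBelow_succ (i + 1) x).const_sub ((m + 1 : ℕ) : ℝ)).add
      (hWlim.mul (tendsto_binomialBelow_succ (m + 1) x))) hev
  rw [sum_poissonBelow_balancedRate hk] at hlim
  have hWpos : 0 < ((m + 1 : ℕ) : ℝ) + poissonBelow (m + 1) x / poissonWeight m x :=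
    add_pos_of_pos_of_nonneg (by positivity) (div_nonneg (poissonBelow_nonneg _ hx0.le) hw.le)
  refine le_of_mul_le_mul_right (hlim.trans_eq ?_) hWpos
  rw [balancedRatio, ← hx]
  ring

/-- A price that guarantees the balanced ratio. -/
noncomputable def balancedPrice (k n : ℕ) (D : ValuationProfile n) : ℝ :=
  if hk : 1 ≤ k then (exists_price_balancedRatio D hk).choose else 0

lemma StaticPricing.expectedWelfare_deterministic (k : ℕ)
    (price : ∀ n : ℕ, ValuationProfile n → ℝ) {n : ℕ} (D : ValuationProfile n) :
    (StaticPricing.deterministic price).expectedWelfare k D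
      = ∫ x, welfare k (price n D) x ∂D.joint :=
  integral_dirac _ _

theorem isCompetitive_balancedPrice {k : ℕ} (hk : 1 ≤ k) :
    (StaticPricing.deterministic (balancedPrice k)).IsCompetitive k (balancedRatio k) := by
  intro n D
  rw [StaticPricing.expectedWelfare_deterministic, balancedPrice, dif_pos hk]
  exact (exists_price_balancedRatio D hk).choose_spec

lemma StaticPricing.competitiveRatio_le {k : ℕ} (hk : 1 ≤ k) (σ : StaticPricing) :
    σ.competitiveRatio k ≤ balancedRatio k :=
  Real.sSup_le (fun _ h => IsCompetitive.le_balancedRatio hk h) (balancedRatio_pos hk).le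

lemma competitiveRatio_balancedPrice {k : ℕ} (hk : 1 ≤ k) :
    (StaticPricing.deterministic (balancedPrice k)).competitiveRatio k = balancedRatio k :=
  IsGreatest.csSup_eq ⟨isCompetitive_balancedPrice hk, fun _ h =>
    StaticPricing.IsCompetitive.le_balancedRatio hk h⟩

lemma isGreatest_balancedRatio {k : ℕ} (hk : 1 ≤ k) :
    IsGreatest (Set.range (StaticPricing.competitiveRatio k)) (balancedRatio k) := by
  refine ⟨⟨_, competitiveRatio_balancedPrice hk⟩, ?_⟩
  rintro _ ⟨σ, rfl⟩
  exact σ.competitiveRatio_le hk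

theorem optimalStaticRatio_eq {k : ℕ} (hk : 1 ≤ k) : optimalStaticRatio k = balancedRatio k :=
  (isGreatest_balancedRatio hk).csSup_eq

/-! ### Asymptotics -/

/-- Its sign at `x` tells on which side of `x` the balanced rate lies. -/
lemma poissonBalance_sub (k : ℕ) (x : ℝ) :
    poissonBalance k x - k = (k - x) * poissonBelow k x - k * (1 - poissonBelow (k + 1) x) := by
  rw [poissonBalance, sum_poissonBelow, poissonBelow_succ]
  ring

lemma poissonWeight_eq_mul {y : ℝ} (hy : y ≠ 0) (x : ℝ) (j : ℕ) :
    poissonWeight j x = Real.exp (y - x) * (x / y) ^ j * poissonWeight j y := by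
  have e : Real.exp (-x) = Real.exp (y - x) * Real.exp (-y) := by rw [← Real.exp_add]; ring_nf
  simp only [poissonWeight, e, div_pow]
  field_simp

/-- Chernoff's bound for the upper tail of a Poisson variable. -/
lemma one_sub_poissonBelow_le {k : ℕ} {x : ℝ} (hx : 0 < x) (hxk : x ≤ k) :
    1 - poissonBelow k x ≤ Real.exp (k - x) * (x / k) ^ k := by
  have hk : (0 : ℝ) < k := hx.trans_le hxk
  have h1 := (hasSum_nat_add_iff' k).2 (hasSum_poissonWeight x)
  have h2 := ((hasSum_nat_add_iff' k).2 (hasSum_poissonWeight k)).mul_left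
    (Real.exp (k - x) * (x / k) ^ k)
  refine (hasSum_le (fun j => ?_) h1 h2).trans ?_
  · rw [poissonWeight_eq_mul hk.ne' x]
    refine mul_le_mul_of_nonneg_right (mul_le_mul_of_nonneg_left ?_ (Real.exp_pos _).le)
      (poissonWeight_nonneg _ hk.le)
    -- Past `k` the likelihood ratio between the means `x` and `k` is at most its value at `k`,
    -- because `x ≤ k`.
    exact pow_le_pow_of_le_one (by positivity) ((div_le_one hk).2 hxk) (by omega)
  · have := poissonBelow_nonneg k hk.le
    exact mul_le_of_le_one_right (by positivity) (by simp only [poissonBelow] at this; linarith)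

lemma exp_mul_one_sub_pow (k : ℕ) {u : ℝ} (hu1 : u < 1) :
    Real.exp (k * u) * (1 - u) ^ k = Real.exp (k * (u + Real.log (1 - u))) := by
  rw [mul_add, Real.exp_add, ← Real.exp_log (show 0 < 1 - u by linarith), ← Real.exp_nat_mul,
    Real.exp_log (show 0 < 1 - u by linarith)]

/-- Chernoff's bound with -log(1 - u) ≥ u + u²/2. -/
lemma one_sub_poissonBelow_le_exp {k : ℕ} (hk : 1 ≤ k) {u : ℝ} (hu0 : 0 ≤ u) (hu1 : u < 1) :
    1 - poissonBelow k (k * (1 - u)) ≤ Real.exp (-(k * u ^ 2 / 2)) := by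
  have hk0 : (0 : ℝ) < k := by exact_mod_cast hk
  refine (one_sub_poissonBelow_le (mul_pos hk0 (by linarith)) (by nlinarith)).trans ?_
  rw [mul_div_cancel_left₀ _ hk0.ne', show (k : ℝ) - k * (1 - u) = k * u by ring,
    exp_mul_one_sub_pow k hu1, Real.exp_le_exp]
  have h := sum_le_hasSum (Finset.range 2) (fun i _ => by positivity)
    (Real.hasSum_pow_div_log_of_abs_lt_one (show |u| < 1 by rwa [abs_of_nonneg hu0]))
  simp only [Finset.sum_range_succ, Finset.sum_range_zero] at h
  norm_num at h
  nlinarith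

/-- The weight at `k` is largest for mean `k`, where Stirling's lower bound for `k!` applies. -/
lemma poissonWeight_self_le {k : ℕ} (hk : 1 ≤ k) {x : ℝ} (hx : 0 ≤ x) :
    poissonWeight k x ≤ 1 / √k := by
  have hk0 : (0 : ℝ) < k := by exact_mod_cast hk
  have h1 : (x / k) ^ k ≤ Real.exp (x - k) := by
    have h0 : 0 ≤ x / k - 1 + 1 := by rw [sub_add_cancel]; positivity
    have h := pow_le_pow_left₀ h0 (Real.add_one_le_exp (x / k - 1)) k
    rw [sub_add_cancel, ← Real.exp_nat_mul] at h
    refine h.trans_eq ?_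
    congr 1
    field_simp
  have h2 : √(k : ℝ) * (k / Real.exp 1) ^ k ≤ k.factorial := by
    refine le_trans (mul_le_mul_of_nonneg_right (Real.sqrt_le_sqrt ?_) (by positivity))
      (Stirling.le_factorial_stirling k)
    nlinarith [Real.pi_gt_three]
  have h3 : Real.exp (-x) * x ^ k ≤ (k / Real.exp 1) ^ k := by
    have h := mul_le_mul_of_nonneg_left h1 (show 0 ≤ Real.exp (-x) * (k : ℝ) ^ k by positivity)
    rw [div_pow, ← Real.exp_nat_mul, mul_one, div_eq_mul_inv _ (Real.exp _),
      ← Real.exp_neg]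
    have e : Real.exp (-x) * (k : ℝ) ^ k * Real.exp (x - k) = k ^ k * Real.exp (-k) := by
      rw [mul_right_comm, ← Real.exp_add, mul_comm]
      ring_nf
    rw [e, mul_assoc] at h
    rwa [div_pow, mul_div_cancel₀ _ (by positivity)] at h
  have hs : 0 < √(k : ℝ) := Real.sqrt_pos.2 hk0
  rw [poissonWeight, div_le_div_iff₀ (by positivity) hs, one_mul, mul_comm]
  exact (mul_le_mul_of_nonneg_left h3 hs.le).trans h2

/-- Stirling's sequence decreases from its first value e/√2. -/
lemma factorial_le_stirling {k : ℕ} (hk : 1 ≤ k) :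
    (k.factorial : ℝ) ≤ Real.exp 1 * √k * (k / Real.exp 1) ^ k := by
  obtain ⟨m, rfl⟩ : ∃ l, k = l + 1 := ⟨k - 1, by omega⟩
  have h := Stirling.stirlingSeq'_antitone (Nat.zero_le m)
  simp only [Function.comp_apply, Nat.succ_eq_add_one, zero_add, Stirling.stirlingSeq_one] at h
  have hk0 : (0 : ℝ) < (m + 1 : ℕ) := by positivity
  rw [Stirling.stirlingSeq, div_le_iff₀ (by positivity)] at h
  refine h.trans_eq ?_
  rw [Real.sqrt_mul (by norm_num)]
  have : √(2 : ℝ) ≠ 0 := by positivity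
  field_simp

/-- Stirling's upper bound with log(1 - u) ≥ -u - u²/2 - 2u³ for u ≤ 1/2. -/
lemma le_poissonWeight_self {k : ℕ} (hk : 1 ≤ k) {u : ℝ} (hu0 : 0 ≤ u) (hu1 : u ≤ 1 / 2) :
    Real.exp (-(k * u ^ 2 / 2) - 2 * k * u ^ 3) / (Real.exp 1 * √k)
      ≤ poissonWeight k (k * (1 - u)) := by
  have hk0 : (0 : ℝ) < k := by exact_mod_cast hk
  have hs : 0 < √(k : ℝ) := Real.sqrt_pos.2 hk0
  have h1 : Real.exp (-(k * u ^ 2 / 2) - 2 * k * u ^ 3) ≤ Real.exp (k * u) * (1 - u) ^ k := by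
    rw [exp_mul_one_sub_pow k (by linarith), Real.exp_le_exp]
    have h := Real.abs_log_sub_add_sum_range_le (show |u| < 1 by rw [abs_of_nonneg hu0]; linarith) 2
    rw [abs_of_nonneg hu0] at h
    have h2 : u ^ 3 / (1 - u) ≤ 2 * u ^ 3 := by
      rw [div_le_iff₀ (by linarith)]
      nlinarith [pow_nonneg hu0 3]
    have h3 := (abs_le.1 h).1
    simp only [Finset.sum_range_succ, Finset.sum_range_zero] at h3
    norm_num at h3
    have h4 : -(u ^ 2 / 2) - 2 * u ^ 3 ≤ u + Real.log (1 - u) := by linarith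
    nlinarith
  have h2 : Real.exp (k * u) * (1 - u) ^ k * (k / Real.exp 1) ^ k
      = Real.exp (-(k * (1 - u))) * (k * (1 - u)) ^ k := by
    rw [div_pow, mul_pow, ← Real.exp_nat_mul, mul_one, div_eq_mul_inv, ← Real.exp_neg,
      show -((k : ℝ) * (1 - u)) = k * u + -k by ring, Real.exp_add]
    ring
  rw [poissonWeight, div_le_div_iff₀ (by positivity) (by positivity), ← h2]
  calc _ ≤ Real.exp (k * u) * (1 - u) ^ k * (Real.exp 1 * √k * (k / Real.exp 1) ^ k) :=
        mul_le_mul h1 (factorial_le_stirling hk) (by positivity)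
          (mul_nonneg (Real.exp_pos _).le (pow_nonneg (by linarith) _))
    _ = _ := by ring

/-- A lower bound of the upper tail of a Poisson variable by `m` terms of comparable size. -/
lemma le_one_sub_poissonBelow {k m : ℕ} (hk : 1 ≤ k) {x : ℝ} (hx : 0 ≤ x) (hxk : x ≤ k)
    (hm : m * (k + m - x) ≤ k / 2) :
    m * poissonWeight k x / 2 ≤ 1 - poissonBelow (k + 1) x := by
  have hk0 : (0 : ℝ) < k := by exact_mod_cast hk
  have hterm : ∀ j ≤ m, poissonWeight k x / 2 ≤ poissonWeight (k + j) x := by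
    intro j hj
    have hjm : (j : ℝ) ≤ m := by exact_mod_cast hj
    -- Each of the next `m` weights keeps at least the fraction `x / (k + m)` of its predecessor. By
    -- Bernoulli's inequality and `hm`, at least half remains after `m` steps.
    have h1 : ∀ i ≤ j, poissonWeight k x * (x / (k + m)) ^ i ≤ poissonWeight (k + i) x := by
      intro i
      induction i with
      | zero => simp
      | succ i ih =>
        intro hi
        have hi' : (i : ℝ) + 1 ≤ m := by exact_mod_cast hi.trans hj
        have e : poissonWeight (k + (i + 1)) x = poissonWeight (k + i) x * (x / (k + i + 1)) := by
          rw [← add_assoc]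
          simp only [poissonWeight, Nat.factorial_succ]
          push_cast
          field_simp
          ring
        rw [e, pow_succ, ← mul_assoc]
        refine mul_le_mul (ih (by omega)) ?_ (by positivity) (poissonWeight_nonneg _ hx)
        exact div_le_div_of_nonneg_left hx (by positivity) (by linarith)
    refine le_trans ?_ (h1 j le_rfl)
    have h2 : (1 : ℝ) / 2 ≤ (x / (k + m)) ^ j := by
      have hm0 : (0 : ℝ) ≤ m := by positivity
      have h3 : 1 + (j : ℝ) * (x / (k + m) - 1) ≤ (1 + (x / (k + m) - 1)) ^ j :=
        one_add_mul_le_pow (by have : 0 ≤ x / (k + m) := by positivity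
                               linarith) j
      rw [add_sub_cancel] at h3
      refine le_trans ?_ h3
      have h4 : x / (k + m) - 1 = -((k + m - x) / (k + m)) := by field_simp; ring
      have h5 : (j : ℝ) * ((k + m - x) / (k + m)) ≤ 1 / 2 := by
        rw [← mul_div_assoc, div_le_iff₀ (by positivity)]
        nlinarith
      rw [h4]
      linarith
    rw [div_eq_mul_one_div]
    exact mul_le_mul_of_nonneg_left h2 (poissonWeight_nonneg k hx)
  have hle := poissonBelow_le_one (k + 1 + m) hx
  rw [poissonBelow, Finset.sum_range_add] at hle
  have hsum : ∑ j ∈ Finset.range m, poissonWeight k x / 2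
      ≤ ∑ j ∈ Finset.range m, poissonWeight (k + 1 + j) x := by
    refine Finset.sum_le_sum fun j hj => ?_
    have := hterm (j + 1) (Finset.mem_range.1 hj)
    rwa [← add_assoc, add_right_comm] at this
  rw [Finset.sum_const, Finset.card_range, nsmul_eq_mul] at hsum
  rw [poissonBelow]
  linarith

/-! ### Asymptotics of the rate and of the ratio -/

lemma tendsto_log_natCast : Tendsto (fun k : ℕ => Real.log k) atTop atTop :=
  Real.tendsto_log_atTop.comp tendsto_natCast_atTop_atTop

lemma exp_log_div_two {k : ℕ} (hk : 1 ≤ k) : Real.exp (Real.log k / 2) = √k := by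
  have hk0 : (0 : ℝ) < k := by exact_mod_cast hk
  rw [Real.sqrt_eq_rpow, Real.rpow_def_of_pos hk0]
  ring_nf

/-- The balanced rate is at least `k - √(k log k)`. -/
lemma eventually_le_balancedRate :
    ∀ᶠ k : ℕ in atTop, (k : ℝ) - √(k * Real.log k) ≤ balancedRate k := by
  filter_upwards [eventually_ge_atTop 4, tendsto_log_natCast.eventually_ge_atTop 4] with k hk hL
  have hk1 : 1 ≤ k := by omega
  have hk0 : (0 : ℝ) < k := by positivity
  set s := √(k : ℝ) with hs
  set r := √(Real.log k) with hr
  have hss : s * s = k := Real.mul_self_sqrt hk0.le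
  have hrr : r * r = Real.log k := Real.mul_self_sqrt (by linarith)
  have hs2 : 2 ≤ s := Real.le_sqrt_of_sq_le (by
    have : (4 : ℝ) ≤ k := by exact_mod_cast hk
    linarith)
  have hr2 : 2 ≤ r := Real.le_sqrt_of_sq_le (by linarith)
  have hrs : r ≤ s := Real.sqrt_le_sqrt ((Real.log_le_sub_one_of_pos hk0).trans (by linarith))
  rw [Real.sqrt_mul hk0.le, ← hs, ← hr]
  have hrs' : r < s := by
    have := Real.log_lt_sub_one_of_pos hk0 (by
      have : (4 : ℝ) ≤ k := by exact_mod_cast hk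
      linarith)
    exact Real.sqrt_lt_sqrt (by linarith) (by linarith)
  have hu0 : 0 ≤ r / s := by positivity
  have hu1 : r / s < 1 := (div_lt_one (by linarith)).2 hrs'
  have e : (k : ℝ) - s * r = k * (1 - r / s) := by
    rw [← hss]
    field_simp
  have hx : 0 ≤ (k : ℝ) - s * r := by nlinarith
  rw [← (strictAntiOn_poissonBalance hk1).le_iff_ge (balancedRate_nonneg k) hx,
    poissonBalance_balancedRate hk1, ← sub_nonneg, poissonBalance_sub]
  have hC := one_sub_poissonBelow_le_exp hk1 hu0 hu1
  -- At u = √(log k / k) the Chernoff bound is exactly 1/√k.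
  have e2 : Real.exp (-(k * (r / s) ^ 2 / 2)) = 1 / s := by
    have : (k : ℝ) * (r / s) ^ 2 / 2 = Real.log k / 2 := by
      rw [← hrr, ← hss]
      field_simp
    rw [this, Real.exp_neg, exp_log_div_two hk1, one_div]
  rw [← e, e2] at hC
  have hmono := poissonBelow_mono (Nat.le_succ k) hx
  have h1 : s * r * (1 - 1 / s) ≤ s * r * poissonBelow k (k - s * r) :=
    mul_le_mul_of_nonneg_left (by linarith) (by positivity)
  have h2 : (k : ℝ) * (1 - poissonBelow (k + 1) (k - s * r)) ≤ k * (1 / s) :=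
    mul_le_mul_of_nonneg_left (by simp only [Nat.succ_eq_add_one] at hmono; linarith) hk0.le
  have h3 : (k : ℝ) * (1 / s) = s := by
    rw [← hss]
    field_simp
  have h4 : s * r * (1 - 1 / s) = s * r - r := by field_simp
  rw [sub_sub_cancel]
  -- What remains is s·r - r - s = (r - 1)(s - 1) - 1 ≥ 0, from `r, s ≥ 2`.
  nlinarith

/-- The balanced rate is at most `k - c √(k log k)` for every `c < 1`. -/
lemma eventually_balancedRate_le {c : ℝ} (hc0 : 0 < c) (hc1 : c < 1) :
    ∀ᶠ k : ℕ in atTop, balancedRate k ≤ k - c * √(k * Real.log k) := by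
  -- Any power of `k` beats (log k)². Exponent 1/2 controls the error terms; exponent (1 - c²)/2 is
  -- the gain from c < 1.
  have hev : ∀ b > 0, ∀ C : ℝ, ∀ᶠ k : ℕ in atTop,
      C * Real.log k ^ 2 ≤ Real.exp (b * Real.log k) := by
    intro b hb C
    have h := ((isLittleO_pow_exp_pos_mul_atTop (k := 2) hb).const_mul_left C).bound one_pos
    filter_upwards [tendsto_log_natCast.eventually h] with k hk
    rw [one_mul, Real.norm_of_nonneg (Real.exp_pos _).le] at hk
    exact (le_abs_self _).trans hk
  have hb : 0 < (1 - c ^ 2) / 2 := by nlinarith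
  filter_upwards [eventually_ge_atTop 1, tendsto_log_natCast.eventually_ge_atTop 16,
    hev (1 / 2) (by norm_num) 2, hev _ hb (4 * Real.exp 1 ^ 2)] with k hk1 hL h1 h2
  have hk0 : (0 : ℝ) < k := by exact_mod_cast hk1
  set s := √(k : ℝ) with hs
  set r := √(Real.log k) with hr
  have hss : s * s = k := Real.mul_self_sqrt hk0.le
  have hrr : r * r = Real.log k := Real.mul_self_sqrt (by linarith)
  have hr4 : 4 ≤ r := Real.le_sqrt_of_sq_le (by linarith)
  have hs0 : 0 < s := Real.sqrt_pos.2 hk0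
  rw [show 1 / 2 * Real.log k = Real.log k / 2 by ring, exp_log_div_two hk1, ← hs, ← hrr] at h1
  rw [← hrr] at h2
  rw [Real.sqrt_mul hk0.le, ← hs, ← hr]
  set u := c * r / s with hu
  have hr1 : 1 ≤ r := by linarith
  have hcr : c * r ≤ r := mul_le_of_le_one_left (by linarith) hc1.le
  have hu0 : 0 ≤ u := by positivity
  have hus : u * s = c * r := div_mul_cancel₀ _ hs0.ne'
  have hr3 : r ^ 3 * 2 ≤ s := by
    have := mul_le_mul_of_nonneg_left hr1 (show 0 ≤ r ^ 3 * 2 by positivity)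
    linarith
  have hu1 : u ≤ 1 / 2 := by
    rw [hu, div_le_iff₀ hs0]
    have := le_self_pow₀ hr1 (show 3 ≠ 0 by norm_num)
    linarith
  have hku : (k : ℝ) * u = c * (s * r) := by
    rw [← hss, mul_assoc, mul_comm s u, hus]
    ring
  have e : (k : ℝ) - c * (s * r) = k * (1 - u) := by rw [← hku]; ring
  rw [e]
  have hx : 0 ≤ (k : ℝ) * (1 - u) := mul_nonneg hk0.le (by linarith)
  rw [← (strictAntiOn_poissonBalance hk1).le_iff_ge hx (balancedRate_nonneg k),
    poissonBalance_balancedRate hk1, ← sub_nonpos, poissonBalance_sub]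
  have hw : Real.exp (-(c ^ 2 * (r * r) / 2)) / (Real.exp 1 ^ 2 * s)
      ≤ poissonWeight k (k * (1 - u)) := by
    refine le_trans ?_ (le_poissonWeight_self hk1 hu0 hu1)
    have e1 : (k : ℝ) * u ^ 2 = c ^ 2 * (r * r) := by
      rw [← hss, show s * s * u ^ 2 = (u * s) ^ 2 by ring, hus]
      ring
    -- The cubic error costs at most a factor e, hence `Real.exp 1 ^ 2` in `hw`.
    have e2 : 2 * k * u ^ 3 ≤ 1 := by
      rw [show 2 * (k : ℝ) * u ^ 3 = 2 * (k * u ^ 2) * u by ring, e1, hu, ← mul_div_assoc,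
        div_le_one hs0]
      have hc3 : c ^ 3 ≤ 1 := pow_le_one₀ hc0.le hc1.le
      have : 2 * (c ^ 2 * (r * r)) * (c * r) = c ^ 3 * (r ^ 3 * 2) := by ring
      rw [this]
      exact (mul_le_of_le_one_left (by positivity) hc3).trans hr3
    rw [e1, pow_two (Real.exp 1), mul_assoc, ← div_div]
    refine div_le_div_of_nonneg_right ?_ (by positivity)
    rw [← Real.exp_sub]
    exact Real.exp_le_exp.2 (by linarith)
  -- About √k / log k terms: few enough for the weights to stay comparable, and only a logarithmic
  -- loss against √k.
  set m := ⌊s / (r * r)⌋₊ with hm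
  have hy1 : 1 ≤ s / (r * r) := by
    rw [le_div_iff₀ (by positivity)]
    have := pow_le_pow_right₀ hr1 (show 2 ≤ 3 by norm_num)
    linarith [show 0 ≤ r ^ 3 by positivity]
  have hm1 : (m : ℝ) ≤ s / (r * r) := Nat.floor_le (by positivity)
  have hm2 : s / (r * r) / 2 ≤ m := by
    have h3 := Nat.lt_floor_add_one (s / (r * r))
    have h4 : (1 : ℝ) ≤ m := by exact_mod_cast Nat.le_floor (by simpa using hy1)
    rw [← hm] at h3
    linarith
  have hmr : m * (r * r) ≤ s := (le_div_iff₀ (by positivity)).1 hm1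
  have hm0 : (0 : ℝ) ≤ m := by positivity
  have hmm : m * (k + m - k * (1 - u)) ≤ (k : ℝ) / 2 := by
    have e1 : (m : ℝ) * (k + m - k * (1 - u)) = m * (k * u) + m * m := by ring
    have h3 : (m : ℝ) * r * 4 ≤ s := by
      have := mul_le_mul_of_nonneg_left hr4 (show 0 ≤ (m : ℝ) * r by positivity)
      linarith
    have h4 : (m : ℝ) * 16 ≤ s := by
      have := mul_le_mul_of_nonneg_left hr4 hm0
      linarith
    rw [e1, hku, ← hss]
    have h5 : (m : ℝ) * (c * (s * r)) ≤ s * s / 4 := by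
      have : (m : ℝ) * (c * (s * r)) ≤ m * (s * r) :=
        mul_le_mul_of_nonneg_left (mul_le_of_le_one_left (by positivity) hc1.le) hm0
      have := mul_le_mul_of_nonneg_left h3 hs0.le
      linarith
    have h6 : (m : ℝ) * m ≤ s * s / 4 := by
      have := mul_le_mul (show (m : ℝ) ≤ s / 2 by linarith) (show (m : ℝ) ≤ s / 2 by linarith)
        hm0 (by positivity)
      linarith
    linarith
  have htail := le_one_sub_poissonBelow hk1 hx (mul_le_of_le_one_right hk0.le (by linarith)) hmm
  have hC := poissonBelow_le_one k hx
  have h3 : (k - k * (1 - u)) * poissonBelow k (k * (1 - u)) ≤ c * (s * r) := by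
    rw [show (k : ℝ) - k * (1 - u) = k * u by ring, hku]
    exact mul_le_of_le_one_right (by positivity) hC
  -- The right side has order at least k^(1 - c²/2) / log k, which beats √(k log k) because c < 1.
  have h4 : c * (s * r) ≤ k * (m * poissonWeight k (k * (1 - u)) / 2) := by
    have e1 : Real.exp ((1 - c ^ 2) / 2 * (r * r)) = s * Real.exp (-(c ^ 2 * (r * r) / 2)) := by
      rw [hs, ← exp_log_div_two hk1, ← Real.exp_add, ← hrr]
      ring_nf
    rw [e1] at h2
    have h5 := mul_le_mul hm2 hw (by positivity) hm0
    have h6 : c * (s * r) ≤ k * (s / (r * r) / 2 *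
        (Real.exp (-(c ^ 2 * (r * r) / 2)) / (Real.exp 1 ^ 2 * s)) / 2) := by
      have e3 : k * (s / (r * r) / 2 *
        (Real.exp (-(c ^ 2 * (r * r) / 2)) / (Real.exp 1 ^ 2 * s)) / 2)
          = s * (s * Real.exp (-(c ^ 2 * (r * r) / 2))) / (4 * Real.exp 1 ^ 2 * (r * r)) := by
        rw [← hss]
        field_simp
        ring
      rw [e3, le_div_iff₀ (by positivity)]
      have h7 := mul_le_mul_of_nonneg_left h2 hs0.le
      refine le_trans ?_ h7
      have h8 : c * r ≤ r * r := hcr.trans (le_mul_of_one_le_left (by linarith) hr1)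
      have h9 := mul_le_mul_of_nonneg_left h8
        (show 0 ≤ s * (4 * Real.exp 1 ^ 2) * (r * r) by positivity)
      linarith
    refine h6.trans (mul_le_mul_of_nonneg_left ?_ hk0.le)
    linarith
  have h5 := mul_le_mul_of_nonneg_left htail hk0.le
  linarith

theorem isLittleO_balancedRate :
    (fun k : ℕ => balancedRate k - ((k : ℝ) - √((k : ℝ) * Real.log k)))
      =o[atTop] fun k : ℕ => √((k : ℝ) * Real.log k) := by
  rw [isLittleO_iff]
  intro ε hε
  -- The maximum keeps the constant positive when ε ≥ 1.
  have hc0 : 0 < max (1 - ε) (1 / 2) := lt_max_of_lt_right (by norm_num)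
  have hc1 : max (1 - ε) (1 / 2) < 1 := max_lt (by linarith) (by norm_num)
  filter_upwards [eventually_le_balancedRate, eventually_balancedRate_le hc0 hc1] with k h1 h2
  have ht := Real.sqrt_nonneg ((k : ℝ) * Real.log k)
  rw [Real.norm_of_nonneg (by linarith), Real.norm_of_nonneg ht]
  have := mul_le_mul_of_nonneg_right (le_max_left (1 - ε) (1 / 2)) ht
  linarith

/-- The balance equation divided by `k`, with P(X > k) = 1 - ρ - P(X = k). So ρ is 1/(1 + v), v = (k
- λ)/k, up to an error of order 1/√k. -/
lemma balancedRatio_mul {k : ℕ} (hk : 1 ≤ k) :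
    balancedRatio k * (1 + (k - balancedRate k) / k)
      = 1 - poissonWeight k (balancedRate k) := by
  have hk0 : (0 : ℝ) < k := by exact_mod_cast hk
  have h := poissonBalance_sub k (balancedRate k)
  rw [poissonBalance_balancedRate hk, poissonBelow_succ, ← balancedRatio] at h
  field_simp
  linarith

theorem isLittleO_balancedRatio :
    (fun k : ℕ => balancedRatio k - (1 - √(Real.log k / k)))
      =o[atTop] fun k : ℕ => √(Real.log k / k) := by
  rw [isLittleO_iff]
  intro ε hε
  have hc0 : 0 < max (1 - ε / 2) (1 / 2) := lt_max_of_lt_right (by norm_num)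
  have hc1 : max (1 - ε / 2) (1 / 2) < 1 := max_lt (by linarith) (by norm_num)
  have hsmall : Tendsto (fun k : ℕ => √(Real.log k / k)) atTop (𝓝 0) := by
    have h := (Real.isLittleO_log_id_atTop.tendsto_div_nhds_zero.comp
      tendsto_natCast_atTop_atTop).sqrt
    rw [Real.sqrt_zero] at h
    exact h
  filter_upwards [eventually_ge_atTop 1, eventually_le_balancedRate,
    eventually_balancedRate_le hc0 hc1, hsmall.eventually_le_const (show 0 < ε / 2 by positivity),
    hsmall.eventually_le_const one_pos,
    tendsto_log_natCast.eventually_ge_atTop ((1 / ε) ^ 2)] with k hk h1 h2 h3 h3' h4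
  have hk0 : (0 : ℝ) < k := by exact_mod_cast hk
  have hs0 : 0 < √(k : ℝ) := Real.sqrt_pos.2 hk0
  have hL : 0 ≤ Real.log k := le_trans (by positivity) h4
  have e : √(k * Real.log k) = k * √(Real.log k / k) := by
    rw [Real.sqrt_mul hk0.le, Real.sqrt_div hL, ← mul_div_assoc, eq_div_iff hs0.ne',
      mul_right_comm, Real.mul_self_sqrt hk0.le]
  rw [e] at h1 h2
  -- The weight is at most 1/√k, negligible against √(log k / k) once log k ≥ 1/ε².
  have hw : poissonWeight k (balancedRate k) ≤ ε * √(Real.log k / k) := by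
    refine (poissonWeight_self_le hk (balancedRate_nonneg k)).trans ?_
    rw [Real.sqrt_div hL, ← mul_div_assoc]
    refine div_le_div_of_nonneg_right ?_ hs0.le
    have h5 := Real.le_sqrt_of_sq_le h4
    rw [div_le_iff₀ hε] at h5
    linarith
  have hw0 := poissonWeight_nonneg k (balancedRate_nonneg k)
  set u := √(Real.log k / k) with hu
  have hu0 : 0 ≤ u := Real.sqrt_nonneg _
  set c := max (1 - ε / 2) (1 / 2)
  have hcε : 1 - ε / 2 ≤ c := le_max_left _ _
  set v := (k - balancedRate k) / k with hv
  have hv1 : v ≤ u := by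
    rw [hv, div_le_iff₀ hk0]
    linarith
  have hv2 : c * u ≤ v := by
    rw [hv, le_div_iff₀ hk0]
    linarith
  have hv0 : 0 ≤ v := le_trans (by positivity) hv2
  have hρ := balancedRatio_mul hk
  rw [← hv] at hρ
  rw [Real.norm_of_nonneg hu0, Real.norm_eq_abs, abs_le]
  constructor
  · have h6 : (1 - v - poissonWeight k (balancedRate k)) * (1 + v)
        ≤ balancedRatio k * (1 + v) := by
      rw [hρ]
      nlinarith
    have := le_of_mul_le_mul_right h6 (by linarith)
    linarith
  -- Uses (1 - v + v²)(1 + v) = 1 + v³ ≥ 1. The error ε·u is shared equally between v² and u - v.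
  · have h6 : balancedRatio k * (1 + v) ≤ (1 - v + v ^ 2) * (1 + v) := by
      rw [hρ]
      nlinarith [pow_nonneg hv0 3]
    have h7 := le_of_mul_le_mul_right h6 (by linarith)
    have h8 : v ^ 2 ≤ ε / 2 * u := by nlinarith
    nlinarith

lemma balancedRatio_eq_poissonNotSoldOut (k : ℕ) :
    balancedRatio k = poissonNotSoldOut k (balancedRate k).toNNReal := by
  rw [poissonNotSoldOut_eq, Real.coe_toNNReal _ (balancedRate_nonneg k), balancedRatio]

lemma balancedRatio_eq_poissonSoldFraction {k : ℕ} (hk : 1 ≤ k) :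
    balancedRatio k = poissonSoldFraction k (balancedRate k).toNNReal := by
  rw [(poissonSoldFraction_eq_iff hk _).2 (Real.coe_toNNReal _ (balancedRate_nonneg k)),
    balancedRatio_eq_poissonNotSoldOut]

theorem mainTheorem4 :
    ∃ lam : ℕ → ℝ≥0,
      -- `lam k` is the unique solution of `E[min(X, k)] / k = Pr(X ≤ k - 1)`, `X ∼ Poisson(lam k)`
      (∀ k : ℕ, 1 ≤ k → ∀ μ : ℝ≥0,
        poissonSoldFraction k μ = poissonNotSoldOut k μ ↔ μ = lam k) ∧
      -- both sides are the best competitive ratio of all static pricing strategies, and a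
      -- deterministic price attains it
      (∀ k : ℕ, 1 ≤ k →
        IsGreatest (Set.range (StaticPricing.competitiveRatio k)) (optimalStaticRatio k) ∧
        (∃ price : ∀ n : ℕ, ValuationProfile n → ℝ,
          (StaticPricing.deterministic price).IsCompetitive k (optimalStaticRatio k) ∧
          (StaticPricing.deterministic price).competitiveRatio k = optimalStaticRatio k) ∧
        optimalStaticRatio k = poissonSoldFraction k (lam k) ∧
        optimalStaticRatio k = poissonNotSoldOut k (lam k)) ∧
      -- the competitive ratio is `1 - √(log k / k) - o(√(log k / k))`
      ((fun k : ℕ => optimalStaticRatio k - (1 - √(Real.log k / k)))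
        =o[atTop] fun k : ℕ => √(Real.log k / k)) ∧
      -- `lam k = k - (1 + o(1)) √(k log k)`
      ((fun k : ℕ => (lam k : ℝ) - ((k : ℝ) - √((k : ℝ) * Real.log k)))
        =o[atTop] fun k : ℕ => √((k : ℝ) * Real.log k)) := by
  refine ⟨fun k => (balancedRate k).toNNReal, fun k hk μ => ?_, fun k hk => ?_, ?_, ?_⟩
  · rw [poissonSoldFraction_eq_iff hk, ← NNReal.coe_inj,
      Real.coe_toNNReal _ (balancedRate_nonneg k)]
  · rw [optimalStaticRatio_eq hk]
    exact ⟨isGreatest_balancedRatio hk, ⟨balancedPrice k, isCompetitive_balancedPrice hk,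
      competitiveRatio_balancedPrice hk⟩, balancedRatio_eq_poissonSoldFraction hk,
      balancedRatio_eq_poissonNotSoldOut k⟩
  · refine isLittleO_balancedRatio.congr' ?_ EventuallyEq.rfl
    filter_upwards [eventually_ge_atTop 1] with k hk
    rw [optimalStaticRatio_eq hk]
  · simp only [Real.coe_toNNReal _ (balancedRate_nonneg _)]
    exact isLittleO_balancedRate
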